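/- Let $n,m\ge 1$, let $\ell,\ell_1,\dots,\ell_n$ be positive integers, put $\gamma=(\ell/\ell_1,\dots,\ell/\ell_n)$, $\|\gamma\|=\sum_k\gamma_k$, and $\alpha\cdot\gamma=\sum_k\alpha_k\gamma_k$ for multi-indices $\alpha$. Let $$\mathcal L=\sum_{\alpha\cdot\gamma=\ell}A_\alpha\,\partial^\alpha$$ be a differential operator on $\mathbb R^n$ with constant complex $m\times m$ matrix coefficients, of order $\ell=\max\{|\alpha|: A_\alpha\ne 0\}$, that is semielliptic: its symbol $L(z)=\sum_{\alpha\cdot\gamma=\ell}A_\alpha (iz)^\alpha$ is an invertible matrix for every nonzero $z\in\mathbb R^n$. Put $\sigma(z)=\sum_k z_k^{2\ell_k}$, $\rho(x)=\sigma(x)^{1/(2\ell)}$, $s^\gamma x=(s^{\gamma_1}x_1,\dots,s^{\gamma_n}x_n)$ for $s>0$, and for every multi-index $\beta$ (including $\beta=0$) define the $m\times m$ matrix functions $$J_\beta(x,t)=\int_{\mathbb R^n}e^{ix\cdot z}(iz)^\beta\sigma(z)e^{-t\sigma(z)}L(z)^{-1}\,dz,\qquad F_\beta(x)=(2\pi)^{-n}\int_0^\infty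 J_\beta(x,t)\,dt,$$ and $$F(x)=F_0(x)=(2\pi)^{-n}\int_0^\infty\int_{\mathbb R^n}e^{ix\cdot z}\sigma(z)e^{-t\sigma(z)}L(z)^{-1}\,dz\,dt .$$ Let $|M|=(\sum_{i,j}|m_{ij}|^2)^{1/2}$ for a matrix $M=(m_{ij})$. Suppose that $\|\gamma\|>\ell$. Then: (a) for every multi-index $\beta$ and every $x\ne 0$, the integral defining $J_\beta(x,t)$ converges absolutely for each $t>0$, the integral over $t\in(0,\infty)$ defining $F_\beta(x)$ converges absolutely, and there is a constant $C$ depending only on $\mathcal L$ and $\beta$ such that $|F_\beta(x)|\le C\,\rho(x)^{\ell-\beta\cdot\gamma-\|\gamma\|}$ for all $x\neq 0$; (b) $F\in C^\infty(\mathbb R^n\setminus\{0\})$, and $\partial^\beta F(x)=F_\beta(x)$ for all multi-indices $\beta$ and all $x\neq0$; (c) for all multi-indices $\beta$, all $s>0$ and all $x\in\mathbb R^n$, $F_\beta(s^\gamma x)=s^{\ell-\beta\cdot\gamma-\|\gamma\|}F_\beta(x)$ (at $x=0$, an entry of $F_\beta(0)$ whose defining integral diverges is read as $0$); (d) $\mathcal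 LF(x)=0$ for all $x\in\mathbb R^n\setminus\{0\}$, where $\mathcal LF=\sum_{\alpha\cdot\gamma=\ell}A_\alpha\,\partial^\alpha F$. -/

import Mathlib

open MeasureTheory Set
open scoped ContDiff

noncomputable section

namespace Semielliptic

/-- The pairing `α · γ = α₁ γ₁ + ⋯ + αₙ γₙ` of a multi-index with a real vector. -/
def dot {n : ℕ} (α : Fin n → ℕ) (γ : Fin n → ℝ) : ℝ := ∑ k, (α k : ℝ) * γ k

/-- The vector `γ = (ℓ/ℓ₁, …, ℓ/ℓₙ)`. -/
def weight {n : ℕ} (l : ℕ) (ls : Fin n → ℕ) : Fin n → ℝ := fun k => (l : ℝ) / (ls k : ℝ)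

/-- The finite set of all multi-indices `α` with `α · γ = ℓ`, where `γ = (ℓ/ℓ₁, …, ℓ/ℓₙ)`.
The bound `α ≤ (ℓ₁, …, ℓₙ)` only makes the set finite: see `mem_indices`. -/
def indices {n : ℕ} (l : ℕ) (ls : Fin n → ℕ) : Finset (Fin n → ℕ) :=
  (Finset.Iic ls).filter (fun α => dot α (weight l ls) = l)

theorem mem_indices {n : ℕ} {l : ℕ} (hl : 0 < l) {ls : Fin n → ℕ} (hls : ∀ k, 0 < ls k)
    (α : Fin n → ℕ) : α ∈ indices l ls ↔ dot α (weight l ls) = l := by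
  simp only [indices, Finset.mem_filter, Finset.mem_Iic, and_iff_right_iff_imp]
  intro h k
  have hk : (0 : ℝ) < ls k := by exact_mod_cast hls k
  have hl' : (0 : ℝ) < l := by exact_mod_cast hl
  have h1 : (α k : ℝ) * weight l ls k ≤ l := by
    rw [← h, dot]
    refine Finset.single_le_sum (f := fun j => (α j : ℝ) * weight l ls j) (fun j _ => ?_)
      (Finset.mem_univ k)
    simp only [weight]
    positivity
  have h2 : (α k : ℝ) * ((l : ℝ) / ls k) ≤ l := h1
  rw [← mul_div_assoc, div_le_iff₀ hk, mul_comm] at h2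
  exact_mod_cast le_of_mul_le_mul_left h2 hl'

/-- `(iz)^α` for a multi-index `α` and a real vector `z`. -/
def iPow {n : ℕ} (z : Fin n → ℝ) (α : Fin n → ℕ) : ℂ := ∏ k, (Complex.I * (z k : ℂ)) ^ α k

/-- The symbol `∑_{α·γ = ℓ} (iz)^α A_α` of the family of coefficients `A`. -/
def symbolOf {n m : ℕ} (l : ℕ) (ls : Fin n → ℕ)
    (A : (Fin n → ℕ) → Matrix (Fin m) (Fin m) ℂ) (z : Fin n → ℝ) : Matrix (Fin m) (Fin m) ℂ :=
  ∑ α ∈ indices l ls, iPow z α • A α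

/-- The norm `|M| = (∑ |M i j|²)^{1/2}` of a complex matrix. -/
def frob {m p : ℕ} (M : Matrix (Fin m) (Fin p) ℂ) : ℝ := √(∑ i, ∑ j, ‖M i j‖ ^ 2)

/-- The first order partial derivative `∂f/∂x_k`. -/
def pderiv {n : ℕ} (k : Fin n) (f : (Fin n → ℝ) → ℂ) : (Fin n → ℝ) → ℂ :=
  fun x => lineDeriv ℝ f x (Pi.single k 1)

/-- The partial derivative `∂^β f = ∂₁^{β₁} (∂₂^{β₂} ( ⋯ ∂ₙ^{βₙ} f))`. -/
def mderiv {n : ℕ} (β : Fin n → ℕ) (f : (Fin n → ℝ) → ℂ) : (Fin n → ℝ) → ℂ :=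
  (List.finRange n).foldr (fun k g => (pderiv k)^[β k] g) f

/-- The partial derivative `∂^β u` of a matrix valued function, taken entrywise. -/
def matDeriv {n m p : ℕ} (β : Fin n → ℕ) (u : (Fin n → ℝ) → Matrix (Fin m) (Fin p) ℂ)
    (x : Fin n → ℝ) : Matrix (Fin m) (Fin p) ℂ :=
  Matrix.of fun i j => mderiv β (fun y => u y i j) x

/-- The anisotropic dilation `s^γ x = (s^{γ₁} x₁, …, s^{γₙ} xₙ)`, used for `s > 0`. -/
def dilate {n : ℕ} (γ : Fin n → ℝ) (s : ℝ) (x : Fin n → ℝ) : Fin n → ℝ :=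
  fun k => s ^ γ k * x k

end Semielliptic

open Semielliptic in
/-- A semielliptic operator `∑_{α·γ = ℓ} A_α ∂^α` in `n` real variables, with constant complex
`m × m` matrix coefficients. The values `A α` with `α · γ ≠ ℓ` play no role. -/
structure SemiellipticOperator (n m : ℕ) where
  /-- the order `ℓ` -/
  l : ℕ
  l_pos : 0 < l
  /-- the positive integers `ℓ₁, …, ℓₙ` -/
  ls : Fin n → ℕ
  ls_pos : ∀ k, 0 < ls k
  /-- the coefficients `A_α` -/
  A : (Fin n → ℕ) → Matrix (Fin m) (Fin m) ℂ
  /-- `ℓ` is the maximum of the `|α|` with `A_α ≠ 0` -/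
  order_eq : IsGreatest {d : ℕ | ∃ α ∈ indices l ls, A α ≠ 0 ∧ ∑ k, α k = d} l
  /-- semiellipticity: the symbol is invertible at all nonzero vectors -/
  invertible : ∀ z : Fin n → ℝ, z ≠ 0 → IsUnit (symbolOf l ls A z)

namespace SemiellipticOperator

open Semielliptic

variable {n m : ℕ} (P : SemiellipticOperator n m)

/-- The vector `γ = (ℓ/ℓ₁, …, ℓ/ℓₙ)`. -/
def γ : Fin n → ℝ := weight P.l P.ls

/-- `‖γ‖ = γ₁ + ⋯ + γₙ`. -/
def γnorm : ℝ := ∑ k, P.γ k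

/-- The symbol `L`. -/
def symbol (z : Fin n → ℝ) : Matrix (Fin m) (Fin m) ℂ := symbolOf P.l P.ls P.A z

/-- The action of the operator on functions whose values have `p` columns of length `m`
(`p = 1`: vector functions; `p = m`: square matrix functions). -/
def act {p : ℕ} (u : (Fin n → ℝ) → Matrix (Fin m) (Fin p) ℂ) (x : Fin n → ℝ) :
    Matrix (Fin m) (Fin p) ℂ :=
  ∑ α ∈ indices P.l P.ls, P.A α * matDeriv α u x

/-- `σ(x) = ∑ x_k^{2ℓ_k}`. -/
def σ (x : Fin n → ℝ) : ℝ := ∑ k, x k ^ (2 * P.ls k)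

/-- `ρ(x) = σ(x)^{1/(2ℓ)}`. -/
def ρ (x : Fin n → ℝ) : ℝ := P.σ x ^ (1 / (2 * (P.l : ℝ)))

/-- The integrand `e^{ix·z} σ(z) e^{-tσ(z)} L(z)⁻¹`. -/
def integrand (x : Fin n → ℝ) (t : ℝ) (z : Fin n → ℝ) : Matrix (Fin m) (Fin m) ℂ :=
  (Complex.exp (Complex.I * ((∑ k, x k * z k : ℝ) : ℂ)) * (P.σ z : ℂ) *
    (Real.exp (-(t * P.σ z)) : ℂ)) • (P.symbol z)⁻¹

/-- The integrand `e^{ix·z} (iz)^β σ(z) e^{-tσ(z)} L(z)⁻¹`. -/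
def integrandβ (β : Fin n → ℕ) (x : Fin n → ℝ) (t : ℝ) (z : Fin n → ℝ) :
    Matrix (Fin m) (Fin m) ℂ :=
  (Complex.exp (Complex.I * ((∑ k, x k * z k : ℝ) : ℂ)) * iPow z β * (P.σ z : ℂ) *
    (Real.exp (-(t * P.σ z)) : ℂ)) • (P.symbol z)⁻¹

/-- The inner integral `J_β(x, t)`; integrals of matrix functions are taken entrywise. -/
def Jβ (β : Fin n → ℕ) (x : Fin n → ℝ) (t : ℝ) : Matrix (Fin m) (Fin m) ℂ :=
  Matrix.of fun i j => ∫ z : Fin n → ℝ, P.integrandβ β x t z i j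

/-- `F(x) = (2π)^{-n} ∫_0^∞ ∫ e^{ix·z} σ(z) e^{-tσ(z)} L(z)⁻¹ dz dt`. -/
def F (x : Fin n → ℝ) : Matrix (Fin m) (Fin m) ℂ :=
  ((2 * Real.pi) ^ n)⁻¹ •
    Matrix.of fun i j => ∫ t in Ioi (0 : ℝ), ∫ z : Fin n → ℝ, P.integrand x t z i j

/-- The formal derivative `F_β(x) = (2π)^{-n} ∫_0^∞ J_β(x, t) dt`. -/
def Fβ (β : Fin n → ℕ) (x : Fin n → ℝ) : Matrix (Fin m) (Fin m) ℂ :=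
  ((2 * Real.pi) ^ n)⁻¹ • Matrix.of fun i j => ∫ t in Ioi (0 : ℝ), P.Jβ β x t i j

end SemiellipticOperator

end

/-
`F_β` is the Fourier transform of the homogeneous function `h = (iz)^β σ L⁻¹` divided by `σ`, where
`1 / σ = ∫₀^∞ e^{-tσ} dt`. For fixed `t > 0` the factor `e^{-tσ}` makes everything converge, and
scaling in `z` gives decay in `t` as `t → ∞` because `‖γ‖ > ℓ`. As `t → 0` the scaling bound blows
up, but if `x_k ≠ 0` each integration by parts in `z_k` gains a fixed positive power of `t` at the
cost of a factor `1 / x_k`; sufficiently many of them make the bound integrable, locally uniformly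
in `x ≠ 0`. So one may differentiate under both integrals, and the homogeneity of `F_β` follows from
that of `h` and `σ` by substitution. Finally `∑ A_α (iz)^α L⁻¹ = 1`, so `𝓛F` is `F_β` with `h`
replaced by `σ`: its inner integral is minus the `t`-derivative of the heat kernel
`∫ e^{ix·z} e^{-tσ} dz`, which tends to zero at both ends of `(0, ∞)` when `x ≠ 0`.
-/

noncomputable section

/-! ### Anisotropically homogeneous functions -/

namespace Semielliptic

variable {n : ℕ} {γ : Fin n → ℝ}

/-- The homogeneous dimension `γ₁ + ⋯ + γₙ`: the dilation `z ↦ s^γ z` multiplies Lebesgue measure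
by `s ^ homDim γ`. -/
def homDim (γ : Fin n → ℝ) : ℝ := ∑ k, γ k

theorem homDim_pos [Nonempty (Fin n)] (hγ : ∀ k, 0 < γ k) : 0 < homDim γ :=
  Finset.sum_pos (fun k _ => hγ k) Finset.univ_nonempty

theorem lt_homDim [Nontrivial (Fin n)] (hγ : ∀ k, 0 < γ k) (k : Fin n) : γ k < homDim γ := by
  obtain ⟨j, hj⟩ := exists_ne k
  exact Finset.single_lt_sum hj (Finset.mem_univ k) (Finset.mem_univ j) (hγ j)
    fun i _ _ => (hγ i).le

theorem dot_nonneg (hγ : ∀ k, 0 ≤ γ k) (α : Fin n → ℕ) : 0 ≤ dot α γ :=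
  Finset.sum_nonneg fun k _ => mul_nonneg (Nat.cast_nonneg _) (hγ k)

theorem dilate_dilate_inv (γ : Fin n → ℝ) {s : ℝ} (hs : 0 < s) (x : Fin n → ℝ) :
    dilate γ s (dilate γ s⁻¹ x) = x := by
  funext k
  simp only [dilate, Real.inv_rpow hs.le]
  exact mul_inv_cancel_left₀ (Real.rpow_pos_of_pos hs _).ne' _

/-- The dilation `z ↦ s^γ z` as a continuous linear automorphism. -/
def dilateEquiv (γ : Fin n → ℝ) {s : ℝ} (hs : 0 < s) : (Fin n → ℝ) ≃L[ℝ] (Fin n → ℝ) :=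
  ContinuousLinearEquiv.piCongrRight fun k =>
    ContinuousLinearEquiv.unitsEquivAut ℝ (Units.mk0 (s ^ γ k) (Real.rpow_pos_of_pos hs _).ne')

@[simp]
theorem coe_dilateEquiv (γ : Fin n → ℝ) {s : ℝ} (hs : 0 < s) :
    ⇑(dilateEquiv γ hs) = dilate γ s := by
  funext z k
  simp [dilateEquiv, dilate, mul_comm]

theorem dilate_ne_zero (γ : Fin n → ℝ) {s : ℝ} (hs : 0 < s) {x : Fin n → ℝ} (hx : x ≠ 0) :
    dilate γ s x ≠ 0 := by
  rw [← coe_dilateEquiv γ hs]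
  exact (dilateEquiv γ hs).map_ne_zero_iff.2 hx

theorem dilate_single (γ : Fin n → ℝ) (s : ℝ) (k : Fin n) (a : ℝ) :
    dilate γ s (Pi.single k a) = s ^ γ k • Pi.single k a := by
  funext j
  rcases eq_or_ne j k with rfl | hj
  · simp [dilate]
  · simp [dilate, hj]

theorem integral_comp_dilate {E : Type*} [NormedAddCommGroup E] [NormedSpace ℝ E]
    (γ : Fin n → ℝ) {s : ℝ} (hs : 0 < s) (g : (Fin n → ℝ) → E) :
    ∫ z, g (dilate γ s z) = s ^ (-homDim γ) • ∫ z, g z := by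
  have hdet : (Matrix.diagonal fun k => s ^ γ k).det = s ^ homDim γ := by
    rw [Matrix.det_diagonal, homDim, Real.rpow_sum_of_pos hs]
  have hpos : 0 < s ^ homDim γ := Real.rpow_pos_of_pos hs _
  have hmap := Real.smul_map_diagonal_volume_pi (D := fun k => s ^ γ k) (hdet ▸ hpos.ne')
  have hcoe : ⇑(Matrix.toLin' (Matrix.diagonal fun k => s ^ γ k)) = dilateEquiv γ hs := by
    funext z k
    simp [dilate, Matrix.mulVec_diagonal]
  rw [hcoe, hdet, abs_of_pos hpos] at hmap
  have hemb : MeasurableEmbedding (dilateEquiv γ hs) :=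
    (dilateEquiv γ hs).toHomeomorph.measurableEmbedding
  calc ∫ z, g (dilate γ s z)
      = s ^ (-homDim γ) • s ^ homDim γ • ∫ z, g (dilateEquiv γ hs z) := by
        rw [coe_dilateEquiv, smul_smul, ← Real.rpow_add hs, neg_add_cancel, Real.rpow_zero,
          one_smul]
    _ = s ^ (-homDim γ) • ∫ z, g z := by
        conv_rhs => rw [← hmap]
        rw [integral_smul_measure, hemb.integral_map, ENNReal.toReal_ofReal hpos.le]

/-- `h` is smooth away from the origin and homogeneous of degree `d` under the dilations
`z ↦ s^γ z`. -/
structure IsHomog {E : Type*} [NormedAddCommGroup E] [NormedSpace ℝ E] (γ : Fin n → ℝ) (d : ℝ)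
    (h : (Fin n → ℝ) → E) : Prop where
  contDiffOn : ContDiffOn ℝ ∞ h {0}ᶜ
  map_dilate : ∀ ⦃s : ℝ⦄, 0 < s → ∀ ⦃z⦄, z ≠ 0 → h (dilate γ s z) = s ^ d • h z

namespace IsHomog

section Vector

variable {E : Type*} [NormedAddCommGroup E] [NormedSpace ℝ E] {d : ℝ} {h : (Fin n → ℝ) → E}

theorem differentiableAt (H : IsHomog γ d h) {z : Fin n → ℝ} (hz : z ≠ 0) :
    DifferentiableAt ℝ h z :=
  (H.contDiffOn.contDiffAt (isOpen_compl_singleton.mem_nhds hz)).differentiableAt (by simp)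

theorem fderiv_dilate (H : IsHomog γ d h) {s : ℝ} (hs : 0 < s) {z : Fin n → ℝ} (hz : z ≠ 0)
    (v : Fin n → ℝ) : fderiv ℝ h (dilate γ s z) (dilate γ s v) = s ^ d • fderiv ℝ h z v := by
  have hcomp : HasFDerivAt (fun y => h (dilate γ s y))
      ((fderiv ℝ h (dilate γ s z)).comp (dilateEquiv γ hs : (Fin n → ℝ) →L[ℝ] Fin n → ℝ)) z := by
    rw [← coe_dilateEquiv γ hs]
    refine HasFDerivAt.comp z (DifferentiableAt.hasFDerivAt ?_) (dilateEquiv γ hs).hasFDerivAt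
    exact H.differentiableAt (by simpa using dilate_ne_zero γ hs hz)
  have hsmul : HasFDerivAt (fun y => h (dilate γ s y)) (s ^ d • fderiv ℝ h z) z := by
    refine ((H.differentiableAt hz).hasFDerivAt.const_smul (s ^ d)).congr_of_eventuallyEq ?_
    filter_upwards [isOpen_compl_singleton.mem_nhds hz] with y hy using H.map_dilate hs hy
  simpa using DFunLike.congr_fun (hcomp.unique hsmul) v

theorem aestronglyMeasurable [Nonempty (Fin n)] (H : IsHomog γ d h) :
    AEStronglyMeasurable h volume := by
  have hae : ∀ᵐ z : Fin n → ℝ, z ∈ ({0}ᶜ : Set (Fin n → ℝ)) := Measure.ae_ne volume 0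
  rw [← Measure.restrict_eq_self_of_ae_mem hae]
  exact H.contDiffOn.continuousOn.aestronglyMeasurable isOpen_compl_singleton.measurableSet

end Vector

section Algebra

variable {𝔸 : Type*} {d d' : ℝ}

theorem mul [NormedRing 𝔸] [NormedAlgebra ℝ 𝔸] {h h' : (Fin n → ℝ) → 𝔸}
    (H : IsHomog γ d h) (H' : IsHomog γ d' h') : IsHomog γ (d + d') (fun z => h z * h' z) where
  contDiffOn := H.contDiffOn.mul H'.contDiffOn
  map_dilate s hs z hz := by
    rw [H.map_dilate hs hz, H'.map_dilate hs hz, smul_mul_smul_comm, Real.rpow_add hs]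

theorem smul {E : Type*} [NormedAddCommGroup E] [NormedSpace ℝ E] {f : (Fin n → ℝ) → ℝ}
    {h : (Fin n → ℝ) → E} (hf : IsHomog γ d f) (H : IsHomog γ d' h) :
    IsHomog γ (d + d') (fun z => f z • h z) where
  contDiffOn := hf.contDiffOn.smul H.contDiffOn
  map_dilate s hs z hz := by
    rw [hf.map_dilate hs hz, H.map_dilate hs hz, smul_eq_mul, mul_smul, Real.rpow_add hs, mul_smul,
      smul_comm (f z)]

theorem const {E : Type*} [NormedAddCommGroup E] [NormedSpace ℝ E] (γ : Fin n → ℝ) (c : E) :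
    IsHomog γ 0 (fun _ => c) where
  contDiffOn := contDiffOn_const
  map_dilate s _ z _ := by rw [Real.rpow_zero, one_smul]

theorem const_mul [NormedRing 𝔸] [NormedAlgebra ℝ 𝔸] {h : (Fin n → ℝ) → 𝔸} (H : IsHomog γ d h)
    (c : 𝔸) : IsHomog γ d (fun z => c * h z) := by
  simpa only [zero_add] using (const γ c).mul H

theorem ofReal {h : (Fin n → ℝ) → ℝ} (H : IsHomog γ d h) : IsHomog γ d (fun z => (h z : ℂ)) where
  contDiffOn := Complex.ofRealCLM.contDiff.comp_contDiffOn H.contDiffOn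
  map_dilate s hs z hz := by
    rw [H.map_dilate hs hz, smul_eq_mul, Complex.ofReal_mul, Complex.real_smul]

theorem coord (γ : Fin n → ℝ) (k : Fin n) : IsHomog γ (γ k) (fun z => z k) where
  contDiffOn := (contDiff_apply ℝ ℝ k).contDiffOn
  map_dilate _ _ _ _ := rfl

theorem pow [NormedRing 𝔸] [NormedAlgebra ℝ 𝔸] {h : (Fin n → ℝ) → 𝔸} (H : IsHomog γ d h)
    (a : ℕ) : IsHomog γ (a * d) (fun z => h z ^ a) where
  contDiffOn := H.contDiffOn.pow a
  map_dilate s hs z hz := by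
    rw [H.map_dilate hs hz, smul_pow, mul_comm, Real.rpow_mul hs.le, Real.rpow_natCast]

theorem prod [NormedCommRing 𝔸] [NormedAlgebra ℝ 𝔸] {ι : Type*} (s : Finset ι) {d : ι → ℝ}
    {h : ι → (Fin n → ℝ) → 𝔸} (H : ∀ i ∈ s, IsHomog γ (d i) (h i)) :
    IsHomog γ (∑ i ∈ s, d i) (fun z => ∏ i ∈ s, h i z) where
  contDiffOn := contDiffOn_prod fun i hi => (H i hi).contDiffOn
  map_dilate r hr z hz := by
    rw [Finset.prod_congr rfl fun i hi => (H i hi).map_dilate hr hz, Finset.prod_smul,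
      Real.rpow_sum_of_pos hr]

theorem rpow {h : (Fin n → ℝ) → ℝ} (H : IsHomog γ d h) (hpos : ∀ z, z ≠ 0 → 0 < h z) (q : ℝ) :
    IsHomog γ (d * q) (fun z => h z ^ q) where
  contDiffOn := H.contDiffOn.rpow_const_of_ne fun z hz => (hpos z hz).ne'
  map_dilate s hs z hz := by
    rw [H.map_dilate hs hz, smul_eq_mul, smul_eq_mul,
      Real.mul_rpow (Real.rpow_pos_of_pos hs _).le (hpos z hz).le, Real.rpow_mul hs.le]

theorem iPow (γ : Fin n → ℝ) (β : Fin n → ℕ) : IsHomog γ (dot β γ) (fun z => iPow z β) :=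
  prod Finset.univ fun k _ => ((coord γ k).ofReal.const_mul Complex.I).pow (β k)

end Algebra

section Pderiv

variable {d : ℝ} {h : (Fin n → ℝ) → ℂ}

theorem pderiv_eq_fderiv (H : IsHomog γ d h) {z : Fin n → ℝ} (hz : z ≠ 0) (k : Fin n) :
    pderiv k h z = fderiv ℝ h z (Pi.single k 1) :=
  (H.differentiableAt hz).lineDeriv_eq_fderiv

theorem hasLineDerivAt (H : IsHomog γ d h) {z : Fin n → ℝ} (hz : z ≠ 0) (k : Fin n) :
    HasLineDerivAt ℝ h (pderiv k h z) z (Pi.single k 1) :=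
  (H.differentiableAt hz).lineDifferentiableAt.hasLineDerivAt

theorem pderiv (H : IsHomog γ d h) (k : Fin n) : IsHomog γ (d - γ k) (pderiv k h) where
  contDiffOn :=
    ((H.contDiffOn.fderiv_of_isOpen isOpen_compl_singleton (by simp)).clm_apply
      contDiffOn_const).congr fun _ hz => H.pderiv_eq_fderiv hz k
  map_dilate s hs z hz := by
    have hs' : s ^ γ k ≠ 0 := (Real.rpow_pos_of_pos hs _).ne'
    have hderiv := H.fderiv_dilate hs hz (Pi.single k 1)
    rw [dilate_single, map_smul, ← H.pderiv_eq_fderiv hz, ← H.pderiv_eq_fderiv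
      (dilate_ne_zero γ hs hz), ← eq_inv_smul_iff₀ hs', smul_smul] at hderiv
    rw [hderiv, Real.rpow_sub hs, div_eq_inv_mul]

end Pderiv

end IsHomog

end Semielliptic

/-! ### Gauges -/

namespace Semielliptic

variable {n : ℕ} {γ : Fin n → ℝ}

/-- The standard continuous function which is positive away from the origin and homogeneous of
degree one under the dilations `z ↦ s^γ z`. -/
def stdGauge (γ z : Fin n → ℝ) : ℝ := ∑ k, |z k| ^ (γ k)⁻¹

theorem stdGauge_dilate (hγ : ∀ k, 0 < γ k) {s : ℝ} (hs : 0 < s) (z : Fin n → ℝ) :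
    stdGauge γ (dilate γ s z) = s * stdGauge γ z := by
  simp only [stdGauge, dilate, Finset.mul_sum]
  refine Finset.sum_congr rfl fun k _ => ?_
  have hsk : 0 ≤ s ^ γ k := (Real.rpow_pos_of_pos hs _).le
  rw [abs_mul, abs_of_nonneg hsk, Real.mul_rpow hsk (abs_nonneg _),
    Real.rpow_rpow_inv hs.le (hγ k).ne']

theorem abs_rpow_le_stdGauge (γ z : Fin n → ℝ) (k : Fin n) : |z k| ^ (γ k)⁻¹ ≤ stdGauge γ z :=
  Finset.single_le_sum (f := fun k => |z k| ^ (γ k)⁻¹)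
    (fun _ _ => Real.rpow_nonneg (abs_nonneg _) _) (Finset.mem_univ k)

theorem stdGauge_pos (γ : Fin n → ℝ) {z : Fin n → ℝ} (hz : z ≠ 0) : 0 < stdGauge γ z := by
  obtain ⟨k, hk⟩ := Function.ne_iff.1 hz
  exact (Real.rpow_pos_of_pos (abs_pos.2 hk) _).trans_le (abs_rpow_le_stdGauge γ z k)

theorem stdGauge_zero (hγ : ∀ k, 0 < γ k) : stdGauge γ 0 = 0 :=
  Finset.sum_eq_zero fun k _ => by simp [(hγ k).ne']

theorem isCompact_stdGauge_eq_one (hγ : ∀ k, 0 < γ k) : IsCompact {z | stdGauge γ z = 1} := by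
  have hcont : Continuous (stdGauge γ) := continuous_finsetSum _ fun k _ =>
    (continuous_apply k).abs.rpow_const fun _ => Or.inr (inv_pos.2 (hγ k)).le
  refine Metric.isCompact_of_isClosed_isBounded (isClosed_eq hcont continuous_const)
    (Metric.isBounded_closedBall (x := (0 : Fin n → ℝ)) (r := 1) |>.subset fun z hz => ?_)
  rw [mem_closedBall_zero_iff, pi_norm_le_iff_of_nonneg zero_le_one]
  intro k
  have hk : |z k| ^ (γ k)⁻¹ ≤ 1 := (abs_rpow_le_stdGauge γ z k).trans_eq hz
  exact le_of_not_gt fun hlt => hk.not_gt (Real.one_lt_rpow hlt (inv_pos.2 (hγ k)))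

theorem IsHomog.exists_norm_le_stdGauge {E : Type*} [NormedAddCommGroup E] [NormedSpace ℝ E]
    {d : ℝ} {h : (Fin n → ℝ) → E} (H : IsHomog γ d h) (hγ : ∀ k, 0 < γ k) :
    ∃ C, 0 < C ∧ ∀ z, z ≠ 0 → ‖h z‖ ≤ C * stdGauge γ z ^ d := by
  have hne : {z | stdGauge γ z = 1} ⊆ {0}ᶜ := by
    rintro _ hz rfl
    exact zero_ne_one ((stdGauge_zero hγ).symm.trans hz)
  obtain ⟨C, hC⟩ := (isCompact_stdGauge_eq_one hγ).exists_bound_of_continuousOn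
    (H.contDiffOn.continuousOn.mono hne)
  refine ⟨max C 1, by positivity, fun z hz => ?_⟩
  set s := stdGauge γ z
  have hs : 0 < s := stdGauge_pos γ hz
  have hunit : stdGauge γ (dilate γ s⁻¹ z) = 1 := by
    rw [stdGauge_dilate hγ (inv_pos.2 hs), inv_mul_cancel₀ hs.ne']
  calc ‖h z‖ = ‖h (dilate γ s (dilate γ s⁻¹ z))‖ := by rw [dilate_dilate_inv γ hs]
    _ = s ^ d * ‖h (dilate γ s⁻¹ z)‖ := by
        rw [H.map_dilate hs (hne hunit), norm_smul,
          Real.norm_of_nonneg (Real.rpow_nonneg hs.le _)]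
    _ ≤ s ^ d * max C 1 := by
        gcongr
        exact (hC _ hunit).trans (le_max_left _ _)
    _ = max C 1 * s ^ d := mul_comm _ _

/-- `σ` is a smooth gauge of degree `D` for the dilations `z ↦ s^γ z`: positive, smooth and
homogeneous of degree `D` away from the origin. The weights are required to lie strictly between
`0` and `D`, as they do for the gauge `∑ z_k ^ (2ℓ_k)` of a semielliptic operator. -/
structure IsGauge (γ : Fin n → ℝ) (D : ℝ) (σ : (Fin n → ℝ) → ℝ) : Prop where
  weight_pos : ∀ k, 0 < γ k
  weight_lt : ∀ k, γ k < D
  pos : ∀ z, z ≠ 0 → 0 < σ z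
  isHomog : IsHomog γ D σ

namespace IsGauge

variable {D : ℝ} {σ : (Fin n → ℝ) → ℝ}

theorem degree_pos [h : Nonempty (Fin n)] (hσ : IsGauge γ D σ) : 0 < D :=
  (hσ.weight_pos h.some).trans (hσ.weight_lt h.some)

theorem exists_norm_le [Nonempty (Fin n)] (hσ : IsGauge γ D σ) {E : Type*} [NormedAddCommGroup E]
    [NormedSpace ℝ E] {d : ℝ} {h : (Fin n → ℝ) → E} (H : IsHomog γ d h) :
    ∃ C, 0 < C ∧ ∀ z, z ≠ 0 → ‖h z‖ ≤ C * σ z ^ (d / D) := by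
  have hquot : IsHomog γ 0 fun z => σ z ^ (-(d / D)) • h z := by
    have := (hσ.isHomog.rpow hσ.pos (-(d / D))).smul H
    rwa [mul_neg, mul_div_cancel₀ _ hσ.degree_pos.ne', neg_add_cancel] at this
  obtain ⟨C, hC, hle⟩ := hquot.exists_norm_le_stdGauge hσ.weight_pos
  refine ⟨C, hC, fun z hz => ?_⟩
  have hσz := hσ.pos z hz
  have hz' := hle z hz
  rwa [norm_smul, Real.rpow_zero, mul_one, Real.norm_of_nonneg (Real.rpow_nonneg hσz.le _),
    Real.rpow_neg hσz.le, inv_mul_le_iff₀ (Real.rpow_pos_of_pos hσz _), mul_comm] at hz'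

theorem exists_mul_abs_rpow_le (hσ : IsGauge γ D σ) :
    ∃ c, 0 < c ∧ ∀ z, z ≠ 0 → ∀ k, c * |z k| ^ (D / γ k) ≤ σ z := by
  obtain ⟨C, hC, hle⟩ :=
    (hσ.isHomog.rpow hσ.pos (-1)).exists_norm_le_stdGauge hσ.weight_pos
  refine ⟨C⁻¹, inv_pos.2 hC, fun z hz k => ?_⟩
  have hσz := hσ.pos z hz
  have hN := stdGauge_pos γ hz
  have hD : 0 ≤ D := ((hσ.weight_pos k).trans (hσ.weight_lt k)).le
  have hcompare : stdGauge γ z ^ D ≤ C * σ z := by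
    have := hle z hz
    rwa [mul_neg_one, Real.rpow_neg hN.le, Real.rpow_neg_one, norm_inv,
      Real.norm_of_nonneg hσz.le, ← div_eq_mul_inv, le_div_iff₀ (Real.rpow_pos_of_pos hN D),
      inv_mul_le_iff₀ hσz, mul_comm] at this
  rw [inv_mul_le_iff₀ hC, div_eq_inv_mul, Real.rpow_mul (abs_nonneg _)]
  exact (Real.rpow_le_rpow (Real.rpow_nonneg (abs_nonneg _) _) (abs_rpow_le_stdGauge γ z k)
    hD).trans hcompare

end IsGauge

end Semielliptic

/-! ### Integrability against `e^{-tσ}` -/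

namespace Semielliptic

theorem integrable_abs_rpow_mul_exp_neg_mul_rpow {p q b : ℝ} (hp : -1 < p) (hq : 0 < q)
    (hb : 0 < b) : Integrable fun x : ℝ => |x| ^ p * Real.exp (-(b * |x| ^ q)) := by
  refine (integrable_fun_norm_addHaar volume
    (f := fun r : ℝ => r ^ p * Real.exp (-(b * r ^ q)))).2 ?_
  simpa using integrableOn_rpow_mul_exp_neg_mul_rpow hp hq hb

theorem exists_rpow_le_mul_exp {q b : ℝ} (hq : 0 ≤ q) (hb : 0 < b) :
    ∃ C, ∀ u, 0 ≤ u → u ^ q ≤ C * Real.exp (b * u) := by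
  have hc : 0 < b / (q + 1) := by positivity
  refine ⟨((b / (q + 1)) ^ q)⁻¹, fun u hu => ?_⟩
  rw [inv_mul_eq_div, le_div_iff₀' (by positivity), ← Real.mul_rpow hc.le hu]
  have hle : b / (q + 1) * u ≤ Real.exp (b / (q + 1) * u) :=
    (le_add_of_nonneg_right zero_le_one).trans (Real.add_one_le_exp _)
  calc (b / (q + 1) * u) ^ q ≤ Real.exp (b / (q + 1) * u) ^ q :=
        Real.rpow_le_rpow (by positivity) hle hq
    _ = Real.exp (b * u * (q / (q + 1))) := by
        rw [← Real.exp_mul]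
        ring_nf
    _ ≤ Real.exp (b * u) := by
        have hfrac : q / (q + 1) ≤ 1 := (div_le_one (by positivity)).2 (by linarith)
        exact Real.exp_le_exp.2 (mul_le_of_le_one_right (by positivity) hfrac)

namespace IsGauge

variable {n : ℕ} {γ : Fin n → ℝ} {D : ℝ} {σ : (Fin n → ℝ) → ℝ}

/- The integrand is a decreasing function `φ` of `σ z`, and `φ (σ z) = ∏ φ (σ z) ^ (γ_k / ‖γ‖)`.
Bounding `σ z` below by a power of `|z_k|` in the `k`-th factor separates the variables. -/
theorem exists_rpow_mul_exp_le_prod [Nonempty (Fin n)] (hσ : IsGauge γ D σ) {q t : ℝ}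
    (hq : q ≤ 0) (ht : 0 < t) :
    ∃ c, 0 < c ∧ ∀ z, (∀ k, z k ≠ 0) → σ z ^ q * Real.exp (-(t * σ z)) ≤
      ∏ k, c ^ (q * γ k / homDim γ) * (|z k| ^ (q * D / homDim γ) *
        Real.exp (-(t * c * γ k / homDim γ * |z k| ^ (D / γ k)))) := by
  obtain ⟨c, hc, hle⟩ := hσ.exists_mul_abs_rpow_le
  have hQ := homDim_pos hσ.weight_pos
  refine ⟨c, hc, fun z hz => ?_⟩
  have hz0 : z ≠ 0 := fun h => hz (Classical.arbitrary _) (congrFun h _)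
  have hσz := hσ.pos z hz0
  have hsum : ∑ k, γ k / homDim γ = 1 := by
    rw [← Finset.sum_div]
    exact div_self hQ.ne'
  have hφ : 0 < σ z ^ q * Real.exp (-(t * σ z)) := by positivity
  calc σ z ^ q * Real.exp (-(t * σ z))
      = ∏ k, (σ z ^ q * Real.exp (-(t * σ z))) ^ (γ k / homDim γ) := by
        rw [← Real.rpow_sum_of_pos hφ, hsum, Real.rpow_one]
    _ ≤ ∏ k, ((c * |z k| ^ (D / γ k)) ^ q * Real.exp (-(t * (c * |z k| ^ (D / γ k))))) ^
          (γ k / homDim γ) := by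
        refine Finset.prod_le_prod (fun _ _ => by positivity) fun k _ => ?_
        have hzk : 0 < |z k| := abs_pos.2 (hz k)
        have hrpow := Real.rpow_le_rpow_of_nonpos (by positivity) (hle z hz0 k) hq
        have hγk := (hσ.weight_pos k).le
        gcongr
        exact hle z hz0 k
    _ = _ := by
        refine Finset.prod_congr rfl fun k _ => ?_
        have hγk := (hσ.weight_pos k).ne'
        rw [Real.mul_rpow (by positivity) (by positivity), ← Real.exp_mul,
          Real.mul_rpow hc.le (by positivity), Real.mul_rpow (by positivity) (by positivity),
          ← Real.rpow_mul hc.le, ← Real.rpow_mul (abs_nonneg _), ← Real.rpow_mul (abs_nonneg _),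
          mul_assoc]
        congr 2
        · field_simp
        · congr 1
          field_simp
        · congr 1
          ring

theorem aestronglyMeasurable_exp [Nonempty (Fin n)] (hσ : IsGauge γ D σ) (t : ℝ) :
    AEStronglyMeasurable (fun z => Real.exp (-(t * σ z))) volume :=
  Real.continuous_exp.comp_aestronglyMeasurable
    (hσ.isHomog.aestronglyMeasurable.const_mul t).neg

theorem ae_pos [Nonempty (Fin n)] (hσ : IsGauge γ D σ) : ∀ᵐ z, 0 < σ z := by
  filter_upwards [Measure.ae_ne volume 0] with z hz using hσ.pos z hz

theorem integrable_rpow_mul_exp_of_nonpos [Nonempty (Fin n)] (hσ : IsGauge γ D σ) {q t : ℝ}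
    (hq : -homDim γ < q * D) (hq0 : q ≤ 0) (ht : 0 < t) :
    Integrable fun z => σ z ^ q * Real.exp (-(t * σ z)) := by
  obtain ⟨c, hc, hle⟩ := hσ.exists_rpow_mul_exp_le_prod hq0 ht
  have hQ := homDim_pos hσ.weight_pos
  have hfactor : ∀ k, Integrable fun x : ℝ => c ^ (q * γ k / homDim γ) * (|x| ^ (q * D / homDim γ) *
      Real.exp (-(t * c * γ k / homDim γ * |x| ^ (D / γ k)))) := fun k => by
    have hγk := hσ.weight_pos k
    refine (integrable_abs_rpow_mul_exp_neg_mul_rpow ?_ (div_pos hσ.degree_pos hγk)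
      (by positivity)).const_mul _
    rwa [lt_div_iff₀ hQ, neg_one_mul]
  refine (Integrable.fintype_prod hfactor).mono'
    ((hσ.isHomog.rpow hσ.pos q).aestronglyMeasurable.mul (hσ.aestronglyMeasurable_exp t)) ?_
  have hne : ∀ᵐ z : Fin n → ℝ, ∀ k, z k ≠ 0 :=
    ae_all_iff.2 fun k => Measure.ae_eval_ne (fun _ => volume) k 0
  filter_upwards [hne, hσ.ae_pos] with z hz hσz
  rw [Real.norm_of_nonneg (by positivity)]
  exact hle z hz

theorem integrable_rpow_mul_exp [Nonempty (Fin n)] (hσ : IsGauge γ D σ) {q t : ℝ}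
    (hq : -homDim γ < q * D) (ht : 0 < t) :
    Integrable fun z => σ z ^ q * Real.exp (-(t * σ z)) := by
  rcases le_total q 0 with hq0 | hq0
  · exact hσ.integrable_rpow_mul_exp_of_nonpos hq hq0 ht
  obtain ⟨C, hle⟩ := exists_rpow_le_mul_exp hq0 (half_pos ht)
  have hQ := homDim_pos hσ.weight_pos
  have hint := hσ.integrable_rpow_mul_exp_of_nonpos (q := 0) (by linarith) le_rfl (half_pos ht)
  refine (hint.const_mul C).mono'
    ((hσ.isHomog.rpow hσ.pos q).aestronglyMeasurable.mul (hσ.aestronglyMeasurable_exp t)) ?_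
  filter_upwards [hσ.ae_pos] with z hz
  rw [Real.norm_of_nonneg (by positivity)]
  calc σ z ^ q * Real.exp (-(t * σ z))
      ≤ C * Real.exp (t / 2 * σ z) * Real.exp (-(t * σ z)) := by
        gcongr
        exact hle _ hz.le
    _ = C * (σ z ^ (0 : ℝ) * Real.exp (-(t / 2 * σ z))) := by
        rw [mul_assoc, ← Real.exp_add, Real.rpow_zero, one_mul]
        ring_nf

theorem integrable_mul_exp [Nonempty (Fin n)] (hσ : IsGauge γ D σ) {d t : ℝ}
    {h : (Fin n → ℝ) → ℂ} (H : IsHomog γ d h) (hd : -homDim γ < d) (ht : 0 < t) :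
    Integrable fun z => h z * (Real.exp (-(t * σ z)) : ℂ) := by
  obtain ⟨C, -, hC⟩ := hσ.exists_norm_le H
  have hint := hσ.integrable_rpow_mul_exp (q := d / D)
    (by rwa [div_mul_cancel₀ _ hσ.degree_pos.ne']) ht
  refine (hint.const_mul C).mono' (H.aestronglyMeasurable.mul
    (Complex.continuous_ofReal.comp_aestronglyMeasurable (hσ.aestronglyMeasurable_exp t))) ?_
  filter_upwards [Measure.ae_ne volume 0] with z hz
  rw [norm_mul, Complex.norm_real, Real.norm_of_nonneg (Real.exp_pos _).le, ← mul_assoc]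
  gcongr
  exact hC z hz

end IsGauge

end Semielliptic

/-! ### Fourier integrals -/

namespace Semielliptic

variable {n : ℕ}

/-- The real linear form `y ↦ ∑ k, y k • c k` whose partial derivatives are the `c k`. -/
def grad : (Fin n → ℂ) ≃L[ℝ] ((Fin n → ℝ) →L[ℝ] ℂ) :=
  (ContinuousLinearEquiv.piRing (Fin n)).symm

theorem grad_apply (c : Fin n → ℂ) (y : Fin n → ℝ) : grad c y = ∑ k, y k • c k :=
  LinearEquiv.piRing_symm_apply (R := ℝ) (S := ℝ) c y

theorem grad_single (c : Fin n → ℂ) (k : Fin n) : grad c (Pi.single k 1) = c k :=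
  congrFun ((ContinuousLinearEquiv.piRing (Fin n)).apply_symm_apply c) k

theorem norm_grad_le (c : Fin n → ℂ) : ‖grad c‖ ≤ ∑ k, ‖c k‖ := by
  refine ContinuousLinearMap.opNorm_le_bound _ (Finset.sum_nonneg fun k _ => norm_nonneg _)
    fun y => ?_
  rw [grad_apply, Finset.sum_mul]
  refine norm_sum_le_of_le _ fun k _ => ?_
  rw [norm_smul, mul_comm]
  gcongr
  exact norm_le_pi_norm y k

theorem hasFDerivAt_integral_of_dominated_of_grad_le {α : Type*} [MeasurableSpace α]
    {μ : Measure α} {f : (Fin n → ℝ) → α → ℂ} {f' : Fin n → (Fin n → ℝ) → α → ℂ}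
    {x₀ : Fin n → ℝ} {s : Set (Fin n → ℝ)} {b : Fin n → α → ℝ} (hs : s ∈ nhds x₀)
    (hf : ∀ x, AEStronglyMeasurable (f x) μ) (hfi : Integrable (f x₀) μ)
    (hf' : ∀ k, AEStronglyMeasurable (f' k x₀) μ)
    (hb : ∀ k, ∀ᵐ a ∂μ, ∀ x ∈ s, ‖f' k x a‖ ≤ b k a) (hbi : ∀ k, Integrable (b k) μ)
    (hd : ∀ᵐ a ∂μ, ∀ x ∈ s, HasFDerivAt (fun x => f x a) (grad fun k => f' k x a) x) :
    HasFDerivAt (fun x => ∫ a, f x a ∂μ) (grad fun k => ∫ a, f' k x₀ a ∂μ) x₀ := by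
  have hfi' : ∀ k, Integrable (f' k x₀) μ := fun k =>
    (hbi k).mono' (hf' k) ((hb k).mono fun a ha => ha x₀ (mem_of_mem_nhds hs))
  have hgrad : ∫ a, grad (fun k => f' k x₀ a) ∂μ = grad fun k => ∫ a, f' k x₀ a ∂μ :=
    (grad.integral_comp_comm _).trans (congrArg grad (funext (eval_integral hfi')))
  rw [← hgrad]
  refine hasFDerivAt_integral_of_dominated_of_fderiv_le (F' := fun x a => grad fun k => f' k x a)
    (bound := fun a => ∑ k, b k a) hs (.of_forall hf) hfi ?_ ?_ (integrable_finsetSum _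
      fun k _ => hbi k) hd
  · exact grad.continuous.comp_aestronglyMeasurable
      (aemeasurable_pi_iff.2 fun k => (hf' k).aemeasurable).aestronglyMeasurable
  · filter_upwards [ae_all_iff.2 hb] with a ha x hx
    exact (norm_grad_le _).trans (Finset.sum_le_sum fun k _ => ha k x hx)

/-- The oscillating factor `e^{ix·z}`. -/
def phase (x z : Fin n → ℝ) : ℂ := Complex.exp (Complex.I * ((∑ k, x k * z k : ℝ) : ℂ))

theorem phase_comm (x z : Fin n → ℝ) : phase x z = phase z x := by
  simp only [phase, mul_comm]

theorem norm_phase (x z : Fin n → ℝ) : ‖phase x z‖ = 1 := by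
  rw [phase, mul_comm, Complex.norm_exp_ofReal_mul_I]

theorem phase_dilate (γ : Fin n → ℝ) (s : ℝ) (x z : Fin n → ℝ) :
    phase (dilate γ s x) z = phase x (dilate γ s z) := by
  simp only [phase, dilate]
  congr 3
  exact Finset.sum_congr rfl fun k _ => by ring

theorem hasFDerivAt_phase (x z : Fin n → ℝ) :
    HasFDerivAt (fun x => phase x z) (grad fun k => Complex.I * z k * phase x z) x := by
  have hexp : (fun x => phase x z) = fun x => Complex.exp (grad (fun k => Complex.I * z k) x) := by
    funext x
    rw [phase, grad_apply]
    push_cast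
    rw [Finset.mul_sum]
    congr 1
    exact Finset.sum_congr rfl fun k _ => by rw [Complex.real_smul]; ring
  have hgrad : (grad fun k => Complex.I * z k * phase x z) =
      phase x z • grad fun k => Complex.I * (z k : ℂ) := by
    ext y
    simp only [grad_apply, smul_apply, smul_eq_mul, Complex.real_smul, Finset.mul_sum]
    exact Finset.sum_congr rfl fun k _ => by ring
  rw [hgrad, hexp, congrFun hexp x]
  exact (ContinuousLinearMap.hasFDerivAt _).cexp

theorem hasLineDerivAt_phase (x z : Fin n → ℝ) (k : Fin n) :
    HasLineDerivAt ℝ (phase x) (Complex.I * x k * phase x z) z (Pi.single k 1) := by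
  have := (hasFDerivAt_phase z x).hasLineDerivAt (Pi.single k 1)
  rw [grad_single] at this
  simpa only [phase_comm _ x] using this

theorem continuous_phase (x : Fin n → ℝ) : Continuous (phase x) := by
  unfold phase
  fun_prop

theorem integrable_phase_mul {g : (Fin n → ℝ) → ℂ} (hg : Integrable g) (x : Fin n → ℝ) :
    Integrable fun z => phase x z * g z :=
  hg.bdd_mul (c := 1) (continuous_phase x).aestronglyMeasurable
    (ae_of_all _ fun z => (norm_phase x z).le)

/- Almost every line parallel to the `k`-th axis avoids the origin, so cutting `f` off on the
null set `z j = 0`, `j ≠ k`, makes it differentiable along all of them. -/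
theorem coord_mul_integral_phase_mul [Nontrivial (Fin n)] {f f' : (Fin n → ℝ) → ℂ} {k : Fin n}
    (hf : Integrable f) (hf' : Integrable f')
    (hder : ∀ z, z ≠ 0 → HasLineDerivAt ℝ f (f' z) z (Pi.single k 1)) (x : Fin n → ℝ) :
    Complex.I * x k * ∫ z, phase x z * f z = -∫ z, phase x z * f' z := by
  obtain ⟨j, hj⟩ := exists_ne k
  let U : Set (Fin n → ℝ) := {z | z j ≠ 0}
  have hU : ∀ᵐ z : Fin n → ℝ, z ∈ U := Measure.ae_eval_ne (fun _ => volume) j 0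
  have hind : ∀ g : (Fin n → ℝ) → ℂ, U.indicator g =ᵐ[volume] g := fun g => by
    filter_upwards [hU] with z hz using indicator_of_mem hz g
  have hmem : ∀ (z : Fin n → ℝ) (s : ℝ), z + s • Pi.single k (1 : ℝ) ∈ U ↔ z ∈ U := fun z s => by
    simp [U, hj]
  have hder' : ∀ z, HasLineDerivAt ℝ (U.indicator f) (U.indicator f' z) z (Pi.single k 1) := by
    intro z
    by_cases hz : z ∈ U
    · have hz0 : z ≠ 0 := fun h => hz (congrFun h j)
      simpa only [HasLineDerivAt, indicator, hmem, hz, if_true] using hder z hz0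
    · simpa only [HasLineDerivAt, indicator, hmem, hz, if_false] using hasDerivAt_const _ _
  have hfU := integrable_phase_mul (hf.congr (hind f).symm) x
  have hparts := integral_bilinear_hasLineDerivAt_right_eq_neg_left_of_integrable
    (μ := volume) (g' := fun z => Complex.I * x k * phase x z) (v := Pi.single k 1)
    (B := ContinuousLinearMap.mul ℝ ℂ)
    (by simpa [mul_comm] using integrable_phase_mul (hf'.congr (hind f').symm) x)
    (by simpa [mul_comm, mul_assoc, mul_left_comm] using hfU.const_mul (Complex.I * x k))
    (by simpa [mul_comm] using hfU)
    (fun z _ => hder' z) (fun z _ => hasLineDerivAt_phase x z k)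
  simp only [ContinuousLinearMap.mul_apply'] at hparts
  rw [← integral_const_mul]
  convert hparts using 1
  · refine integral_congr_ae ?_
    filter_upwards [hind f] with z hz
    rw [hz]
    ring
  · congr 1
    refine integral_congr_ae ?_
    filter_upwards [hind f'] with z hz
    rw [hz, mul_comm]

end Semielliptic

/-! ### Damped Fourier integrals -/

namespace Semielliptic

variable {n : ℕ} {γ : Fin n → ℝ} {D d : ℝ} {σ : (Fin n → ℝ) → ℝ} {h : (Fin n → ℝ) → ℂ}

/-- The Fourier integral of `h` damped by `e^{-tσ}`; for `h = 1` it is the heat kernel of the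
operator with symbol `σ`. -/
def heatFourier (σ : (Fin n → ℝ) → ℝ) (h : (Fin n → ℝ) → ℂ) (x : Fin n → ℝ) (t : ℝ) : ℂ :=
  ∫ z, phase x z * (h z * (Real.exp (-(t * σ z)) : ℂ))

/-- Multiplication by `i z_k`, the Fourier multiplier of `∂/∂x_k`. -/
def coordMul (k : Fin n) (h : (Fin n → ℝ) → ℂ) : (Fin n → ℝ) → ℂ :=
  fun z => Complex.I * z k * h z

theorem IsHomog.coordMul (H : IsHomog γ d h) (k : Fin n) :
    IsHomog γ (γ k + d) (coordMul k h) :=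
  ((IsHomog.coord γ k).ofReal.const_mul Complex.I).mul H

theorem heatFourier_congr [Nonempty (Fin n)] {h' : (Fin n → ℝ) → ℂ} (hh : ∀ z, z ≠ 0 → h z = h' z) :
    heatFourier σ h = heatFourier σ h' := by
  funext x t
  refine integral_congr_ae ?_
  filter_upwards [Measure.ae_ne volume 0] with z hz
  rw [hh z hz]

theorem norm_heatFourier_le (σ : (Fin n → ℝ) → ℝ) (h : (Fin n → ℝ) → ℂ) (x : Fin n → ℝ) (t : ℝ) :
    ‖heatFourier σ h x t‖ ≤ ∫ z, ‖h z * (Real.exp (-(t * σ z)) : ℂ)‖ := by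
  refine (norm_integral_le_integral_norm _).trans_eq ?_
  simp only [norm_mul (phase x _), norm_phase, one_mul]

namespace IsGauge

theorem heatFourier_dilate [Nonempty (Fin n)] (hσ : IsGauge γ D σ) (H : IsHomog γ d h) {s : ℝ}
    (hs : 0 < s) (x : Fin n → ℝ) (t : ℝ) :
    heatFourier σ h (dilate γ s x) t =
      s ^ (-homDim γ - d) • heatFourier σ h x (s ^ (-D) * t) := by
  have hscale : ∀ᵐ z : Fin n → ℝ, phase x (dilate γ s z) * (h (dilate γ s z) *
      (Real.exp (-(s ^ (-D) * t * σ (dilate γ s z))) : ℂ)) =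
      s ^ d • (phase (dilate γ s x) z * (h z * (Real.exp (-(t * σ z)) : ℂ))) := by
    filter_upwards [Measure.ae_ne volume 0] with z hz
    have hexp : s ^ (-D) * t * (s ^ D * σ z) = t * σ z := by
      rw [Real.rpow_neg hs.le]
      have := Real.rpow_pos_of_pos hs D
      field_simp
    rw [phase_dilate, H.map_dilate hs hz, hσ.isHomog.map_dilate hs hz, smul_eq_mul, hexp,
      smul_mul_assoc, mul_smul_comm]
  have hsub : s ^ d • heatFourier σ h (dilate γ s x) t =
      s ^ (-homDim γ) • heatFourier σ h x (s ^ (-D) * t) :=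
    (integral_smul _ _).symm.trans ((integral_congr_ae hscale).symm.trans
      (integral_comp_dilate γ hs fun z =>
        phase x z * (h z * (Real.exp (-(s ^ (-D) * t * σ z)) : ℂ))))
  rw [sub_eq_neg_add, Real.rpow_add hs, mul_smul, ← hsub, Real.rpow_neg hs.le,
    inv_smul_smul₀ (Real.rpow_pos_of_pos hs d).ne']

theorem hasLineDerivAt_mul_exp (hσ : IsGauge γ D σ) (H : IsHomog γ d h) (t : ℝ)
    {z : Fin n → ℝ} (hz : z ≠ 0) (k : Fin n) :
    HasLineDerivAt ℝ (fun z => h z * (Real.exp (-(t * σ z)) : ℂ))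
      (pderiv k h z * (Real.exp (-(t * σ z)) : ℂ) -
        t * (h z * pderiv k (fun z => (σ z : ℂ)) z * (Real.exp (-(t * σ z)) : ℂ)))
      z (Pi.single k 1) := by
  have hh := H.hasLineDerivAt hz k
  have hσ' := hσ.isHomog.ofReal.hasLineDerivAt hz k
  unfold HasLineDerivAt at hh hσ' ⊢
  have hprod := hh.mul ((hσ'.const_mul (t : ℂ)).neg.cexp)
  simp only [Pi.neg_apply, zero_smul, add_zero] at hprod
  push_cast
  exact hprod.congr_deriv (by ring)

variable [Nontrivial (Fin n)]

theorem coord_mul_heatFourier (hσ : IsGauge γ D σ) (H : IsHomog γ d h) (k : Fin n)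
    (hd : γ k - homDim γ < d) {t : ℝ} (ht : 0 < t) (x : Fin n → ℝ) :
    Complex.I * x k * heatFourier σ h x t =
      t * heatFourier σ (fun z => h z * pderiv k (fun z => (σ z : ℂ)) z) x t -
        heatFourier σ (pderiv k h) x t := by
  have hk := hσ.weight_pos k
  have hkD := hσ.weight_lt k
  have hint := hσ.integrable_mul_exp H (by linarith) ht
  have hint₁ := hσ.integrable_mul_exp (H.pderiv k) (by linarith) ht
  have hint₂ := hσ.integrable_mul_exp (H.mul (hσ.isHomog.ofReal.pderiv k)) (by linarith) ht
  rw [heatFourier, coord_mul_integral_phase_mul hint (hint₁.sub (hint₂.const_mul (t : ℂ)))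
    (fun z hz => hσ.hasLineDerivAt_mul_exp H t hz k), heatFourier, heatFourier,
    ← integral_const_mul, ← integral_sub ((integrable_phase_mul hint₂ x).const_mul _)
      (integrable_phase_mul hint₁ x), ← integral_neg]
  refine integral_congr_ae (ae_of_all _ fun z => ?_)
  simp only [Pi.sub_apply]
  ring

theorem exists_norm_heatFourier_le (hσ : IsGauge γ D σ) (H : IsHomog γ d h) :
    ∃ C, ∀ x t, 0 < t → ‖heatFourier σ h x t‖ ≤ C * t ^ ((-homDim γ - d) / D) := by
  refine ⟨∫ z, ‖h z * (Real.exp (-(1 * σ z)) : ℂ)‖, fun x t ht => ?_⟩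
  have hD := hσ.degree_pos
  have hs : 0 < t ^ D⁻¹ := Real.rpow_pos_of_pos ht _
  have htime : (t ^ D⁻¹) ^ (-D) * t = 1 := by
    rw [← Real.rpow_mul ht.le, mul_neg, inv_mul_cancel₀ hD.ne', Real.rpow_neg_one,
      inv_mul_cancel₀ ht.ne']
  rw [← dilate_dilate_inv γ hs x, hσ.heatFourier_dilate H hs, htime, norm_smul,
    Real.norm_of_nonneg (by positivity), ← Real.rpow_mul ht.le, inv_mul_eq_div, mul_comm]
  gcongr
  exact norm_heatFourier_le σ h _ 1

/- Each integration by parts trades one factor `x k` for the power `t ^ (γ k / D)`. -/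
theorem exists_abs_pow_mul_norm_heatFourier_le (hσ : IsGauge γ D σ) (k : Fin n) (a : ℕ) :
    ∀ {d : ℝ} {h : (Fin n → ℝ) → ℂ}, IsHomog γ d h → a * γ k < homDim γ + d →
      ∃ C, ∀ x t, 0 < t →
        |x k| ^ a * ‖heatFourier σ h x t‖ ≤ C * t ^ ((a * γ k - homDim γ - d) / D) := by
  have hk := hσ.weight_pos k
  have hkD := hσ.weight_lt k
  have hD := hσ.degree_pos
  induction a with
  | zero => exact fun H _ => by simpa using hσ.exists_norm_heatFourier_le H
  | succ a ih =>
    intro d h H hd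
    push_cast at hd
    have ha : 0 ≤ (a : ℝ) * γ k := by positivity
    obtain ⟨C₁, hC₁⟩ := ih (H.pderiv k) (by linarith)
    obtain ⟨C₂, hC₂⟩ := ih (H.mul (hσ.isHomog.ofReal.pderiv k)) (by linarith)
    refine ⟨C₂ + C₁, fun x t ht => ?_⟩
    set h₁ := heatFourier σ (pderiv k h) x t
    set h₂ := heatFourier σ (fun z => h z * pderiv k (fun z => (σ z : ℂ)) z) x t
    have hparts : |x k| * ‖heatFourier σ h x t‖ ≤ t * ‖h₂‖ + ‖h₁‖ := by
      have := congrArg norm (hσ.coord_mul_heatFourier H k (by linarith) ht x)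
      simp only [norm_mul, Complex.norm_I, one_mul, Complex.norm_real, Real.norm_eq_abs] at this
      rw [this]
      refine (norm_sub_le _ _).trans_eq ?_
      rw [norm_mul, Complex.norm_real, Real.norm_of_nonneg ht.le]
    have hexp₂ : t * t ^ ((a * γ k - homDim γ - (d + (D - γ k))) / D) =
        t ^ (((a + 1 : ℕ) * γ k - homDim γ - d) / D) := by
      rw [show ((a + 1 : ℕ) * γ k - homDim γ - d) / D =
        1 + (a * γ k - homDim γ - (d + (D - γ k))) / D by push_cast; field_simp; ring,
        Real.rpow_add ht, Real.rpow_one]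
    have hexp₁ : (a * γ k - homDim γ - (d - γ k)) / D =
        ((a + 1 : ℕ) * γ k - homDim γ - d) / D := by
      push_cast
      ring
    calc |x k| ^ (a + 1) * ‖heatFourier σ h x t‖
        = |x k| ^ a * (|x k| * ‖heatFourier σ h x t‖) := by ring
      _ ≤ |x k| ^ a * (t * ‖h₂‖ + ‖h₁‖) := by gcongr
      _ = t * (|x k| ^ a * ‖h₂‖) + |x k| ^ a * ‖h₁‖ := by ring
      _ ≤ t * (C₂ * t ^ ((a * γ k - homDim γ - (d + (D - γ k))) / D)) +
          C₁ * t ^ ((a * γ k - homDim γ - (d - γ k)) / D) :=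
        add_le_add (mul_le_mul_of_nonneg_left (hC₂ x t ht) ht.le) (hC₁ x t ht)
      _ = (C₂ + C₁) * t ^ (((a + 1 : ℕ) * γ k - homDim γ - d) / D) := by
        rw [mul_left_comm, hexp₂, hexp₁, add_mul]

theorem exists_abs_pow_mul_norm_heatFourier_le_rpow (hσ : IsGauge γ D σ) (H : IsHomog γ d h)
    (hd : D - homDim γ < d) (k : Fin n) :
    ∃ (a : ℕ) (e C : ℝ), -1 < e ∧ ∀ x t, 0 < t →
      |x k| ^ a * ‖heatFourier σ h x t‖ ≤ C * t ^ e := by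
  have hk := hσ.weight_pos k
  have hkD := hσ.weight_lt k
  obtain ⟨a, hlt, hle⟩ : ∃ a : ℕ, homDim γ + d - D < a * γ k ∧ a * γ k < homDim γ + d := by
    refine ⟨⌊(homDim γ + d - D) / γ k⌋₊ + 1, ?_, ?_⟩
    · push_cast
      rw [← div_lt_iff₀ hk]
      exact Nat.lt_floor_add_one _
    · have := Nat.floor_le (div_nonneg (by linarith : 0 ≤ homDim γ + d - D) hk.le)
      rw [le_div_iff₀ hk] at this
      push_cast
      linarith
  obtain ⟨C, hC⟩ := hσ.exists_abs_pow_mul_norm_heatFourier_le k a H hle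
  refine ⟨a, _, C, ?_, hC⟩
  rw [lt_div_iff₀ hσ.degree_pos]
  linarith

end IsGauge

theorem integrableOn_Ioi_piecewise_rpow {e e' : ℝ} (he : -1 < e) (he' : e' < -1) (A B : ℝ) :
    IntegrableOn ((Iic (1 : ℝ)).piecewise (fun t => A * t ^ e) fun t => B * t ^ e') (Ioi 0) := by
  refine Integrable.piecewise measurableSet_Iic (Integrable.const_mul ?_ A)
    (Integrable.const_mul ?_ B)
  · rw [Measure.restrict_restrict measurableSet_Iic, inter_comm, Ioi_inter_Iic]
    exact (intervalIntegrable_iff_integrableOn_Ioc_of_le zero_le_one).1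
      (intervalIntegral.intervalIntegrable_rpow' he)
  · rw [Measure.restrict_restrict measurableSet_Iic.compl, compl_Iic, Ioi_inter_Ioi,
      max_eq_left zero_le_one]
    exact integrableOn_Ioi_rpow_of_lt he' one_pos

namespace IsGauge

variable [Nontrivial (Fin n)]

theorem exists_integrableOn_norm_heatFourier_le (hσ : IsGauge γ D σ) (H : IsHomog γ d h)
    (hd : D - homDim γ < d) (k : Fin n) {r : ℝ} (hr : 0 < r) :
    ∃ b : ℝ → ℝ, IntegrableOn b (Ioi 0) ∧ ∀ x : Fin n → ℝ, r ≤ |x k| → ∀ t, 0 < t →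
      ‖heatFourier σ h x t‖ ≤ b t := by
  obtain ⟨a, e, A, he, hA⟩ := hσ.exists_abs_pow_mul_norm_heatFourier_le_rpow H hd k
  obtain ⟨B, hB⟩ := hσ.exists_norm_heatFourier_le H
  have he' : (-homDim γ - d) / D < -1 := by
    rw [div_lt_iff₀ hσ.degree_pos]
    linarith
  refine ⟨_, integrableOn_Ioi_piecewise_rpow he he' (A / r ^ a) B, fun x hx t ht => ?_⟩
  by_cases ht1 : t ∈ Iic 1
  · rw [piecewise_eq_of_mem _ _ _ ht1, div_mul_eq_mul_div, le_div_iff₀ (by positivity), mul_comm]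
    refine le_trans ?_ (hA x t ht)
    gcongr
  · rw [piecewise_eq_of_notMem _ _ _ ht1]
    exact hB x t ht

theorem hasFDerivAt_heatFourier (hσ : IsGauge γ D σ) (H : IsHomog γ d h) (hd : -homDim γ < d)
    {t : ℝ} (ht : 0 < t) (x : Fin n → ℝ) : HasFDerivAt (fun x => heatFourier σ h x t)
      (grad fun k => heatFourier σ (coordMul k h) x t) x := by
  have hi := hσ.integrable_mul_exp H hd ht
  have hi' : ∀ k, Integrable fun z => coordMul k h z * (Real.exp (-(t * σ z)) : ℂ) := fun k =>
    hσ.integrable_mul_exp (H.coordMul k) (by linarith [hσ.weight_pos k]) ht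
  refine hasFDerivAt_integral_of_dominated_of_grad_le
    (f := fun x z => phase x z * (h z * (Real.exp (-(t * σ z)) : ℂ)))
    (f' := fun k x z => phase x z * (coordMul k h z * (Real.exp (-(t * σ z)) : ℂ)))
    Filter.univ_mem (fun x => (integrable_phase_mul hi x).aestronglyMeasurable)
    (integrable_phase_mul hi x) (fun k => (integrable_phase_mul (hi' k) x).aestronglyMeasurable)
    (fun k => ae_of_all _ fun z x _ => ?_) (fun k => (hi' k).norm)
    (ae_of_all _ fun z x _ => ?_)
  · rw [norm_mul, norm_phase, one_mul]
  · refine ((hasFDerivAt_phase x z).mul_const (h z * (Real.exp (-(t * σ z)) : ℂ))).congr_fderiv ?_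
    ext y
    simp only [smul_apply, grad_apply, smul_eq_mul, Complex.real_smul, Finset.mul_sum, coordMul]
    exact Finset.sum_congr rfl fun k _ => by ring

theorem hasDerivAt_heatFourier (hσ : IsGauge γ D σ) (H : IsHomog γ d h) (hd : -homDim γ < d)
    {t : ℝ} (ht : 0 < t) (x : Fin n → ℝ) : HasDerivAt (fun t => heatFourier σ h x t)
      (-heatFourier σ (fun z => h z * σ z) x t) t := by
  have hi : ∀ t : ℝ, 0 < t → Integrable fun z => h z * (Real.exp (-(t * σ z)) : ℂ) :=
    fun t ht => hσ.integrable_mul_exp H hd ht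
  have hi' : ∀ t : ℝ, 0 < t → Integrable fun z => h z * σ z * (Real.exp (-(t * σ z)) : ℂ) :=
    fun t ht => hσ.integrable_mul_exp (H.mul hσ.isHomog.ofReal) (by linarith [hσ.degree_pos]) ht
  rw [heatFourier, ← integral_neg]
  refine (hasDerivAt_integral_of_dominated_loc_of_deriv_le
    (F := fun t z => phase x z * (h z * (Real.exp (-(t * σ z)) : ℂ)))
    (F' := fun t z => -(phase x z * (h z * σ z * (Real.exp (-(t * σ z)) : ℂ))))
    (bound := fun z => ‖h z * σ z * (Real.exp (-(t / 2 * σ z)) : ℂ)‖)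
    (Ioi_mem_nhds (half_lt_self ht)) ?_ (integrable_phase_mul (hi t ht) x)
    (integrable_phase_mul (hi' t ht) x).neg.aestronglyMeasurable
    ?_ (hi' _ (half_pos ht)).norm (ae_of_all _ fun z u _ => ?_)).2
  · filter_upwards [Ioi_mem_nhds ht] with u hu
    exact (integrable_phase_mul (hi u hu) x).aestronglyMeasurable
  · filter_upwards [hσ.ae_pos] with z hz u hu
    simp only [norm_neg, norm_mul, norm_phase, one_mul, Complex.norm_real, Real.norm_eq_abs,
      Real.abs_exp]
    gcongr
    exact (mem_Ioi.1 hu).le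
  · have hexp : HasDerivAt (fun u : ℝ => ((Real.exp (-(u * σ z)) : ℝ) : ℂ))
        ((Real.exp (-(u * σ z)) * -(1 * σ z) : ℝ) : ℂ) u :=
      (((hasDerivAt_id u).mul_const (σ z)).neg.exp).ofReal_comp
    refine ((hexp.const_mul (h z)).const_mul (phase x z)).congr_deriv ?_
    push_cast
    ring

theorem aestronglyMeasurable_heatFourier (hσ : IsGauge γ D σ) (H : IsHomog γ d h)
    (hd : -homDim γ < d) (x : Fin n → ℝ) :
    AEStronglyMeasurable (heatFourier σ h x) (volume.restrict (Ioi 0)) :=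
  ContinuousOn.aestronglyMeasurable
    (fun _ ht => (hσ.hasDerivAt_heatFourier H hd ht x).continuousAt.continuousWithinAt)
    measurableSet_Ioi

theorem integrableOn_heatFourier (hσ : IsGauge γ D σ) (H : IsHomog γ d h)
    (hd : D - homDim γ < d) {x : Fin n → ℝ} (hx : x ≠ 0) :
    IntegrableOn (heatFourier σ h x) (Ioi 0) := by
  obtain ⟨k, hk⟩ := Function.ne_iff.1 hx
  obtain ⟨b, hb, hle⟩ := hσ.exists_integrableOn_norm_heatFourier_le H hd k (abs_pos.2 hk)
  refine Integrable.mono' hb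
    (hσ.aestronglyMeasurable_heatFourier H (by linarith [hσ.degree_pos]) x) ?_
  filter_upwards [ae_restrict_mem measurableSet_Ioi] with t ht
  exact hle x le_rfl t ht

end IsGauge

end Semielliptic

/-! ### Integration over `t` -/

namespace Semielliptic

variable {n : ℕ} {γ : Fin n → ℝ} {D d : ℝ} {σ : (Fin n → ℝ) → ℝ} {h : (Fin n → ℝ) → ℂ}
  {x : Fin n → ℝ}

/-- The Fourier integral of `h / σ`, regularised by writing `1 / σ = ∫₀^∞ e^{-tσ} dt` and
integrating over `t` last. -/
def fourierDiv (σ : (Fin n → ℝ) → ℝ) (h : (Fin n → ℝ) → ℂ) (x : Fin n → ℝ) : ℂ :=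
  ∫ t in Ioi (0 : ℝ), heatFourier σ h x t

theorem fourierDiv_congr [Nonempty (Fin n)] {h' : (Fin n → ℝ) → ℂ}
    (hh : ∀ z, z ≠ 0 → h z = h' z) : fourierDiv σ h = fourierDiv σ h' := by
  unfold fourierDiv
  rw [heatFourier_congr hh]

theorem fourierDiv_const_mul (c : ℂ) (h : (Fin n → ℝ) → ℂ) (x : Fin n → ℝ) :
    fourierDiv σ (fun z => c * h z) x = c * fourierDiv σ h x := by
  simp only [fourierDiv, heatFourier, mul_assoc, mul_left_comm _ c, integral_const_mul]

namespace IsGauge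

theorem fourierDiv_dilate [Nonempty (Fin n)] (hσ : IsGauge γ D σ) (H : IsHomog γ d h) {s : ℝ}
    (hs : 0 < s) (x : Fin n → ℝ) :
    fourierDiv σ h (dilate γ s x) = s ^ (D - homDim γ - d) • fourierDiv σ h x := by
  have hsD : 0 < s ^ (-D) := Real.rpow_pos_of_pos hs _
  simp only [fourierDiv, hσ.heatFourier_dilate H hs]
  rw [integral_smul, integral_comp_mul_left_Ioi (heatFourier σ h x) 0 hsD, mul_zero, smul_smul,
    ← Real.rpow_neg hs.le, neg_neg, ← Real.rpow_add hs]
  congr 2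
  ring

variable [Nontrivial (Fin n)]

theorem hasFDerivAt_fourierDiv (hσ : IsGauge γ D σ) (H : IsHomog γ d h)
    (hd : D - homDim γ < d) (hx : x ≠ 0) :
    HasFDerivAt (fourierDiv σ h) (grad fun k => fourierDiv σ (coordMul k h) x) x := by
  have hD := hσ.degree_pos
  obtain ⟨j, hj⟩ := Function.ne_iff.1 hx
  have hj' : 0 < |x j| := abs_pos.2 hj
  have hd' : ∀ k, D - homDim γ < γ k + d := fun k => by linarith [hσ.weight_pos k]
  choose b hb hle using fun k =>
    hσ.exists_integrableOn_norm_heatFourier_le (H.coordMul k) (hd' k) j (half_pos hj')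
  have hs : {y : Fin n → ℝ | |x j| / 2 < |y j|} ∈ nhds x :=
    (isOpen_lt continuous_const (by fun_prop)).mem_nhds (half_lt_self hj')
  refine hasFDerivAt_integral_of_dominated_of_grad_le hs
    (fun x => hσ.aestronglyMeasurable_heatFourier H (by linarith) x)
    (hσ.integrableOn_heatFourier H hd hx)
    (fun k => hσ.aestronglyMeasurable_heatFourier (H.coordMul k) (by linarith [hd' k]) x)
    (fun k => ?_) hb ?_
  · filter_upwards [ae_restrict_mem measurableSet_Ioi] with t ht y hy
    exact hle k y (le_of_lt hy) t ht
  · filter_upwards [ae_restrict_mem measurableSet_Ioi] with t ht y _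
    exact hσ.hasFDerivAt_heatFourier H (by linarith) ht y

theorem contDiffOn_nat_fourierDiv (hσ : IsGauge γ D σ) (N : ℕ) :
    ∀ {d : ℝ} {h : (Fin n → ℝ) → ℂ}, IsHomog γ d h → D - homDim γ < d →
      ContDiffOn ℝ N (fourierDiv σ h) {0}ᶜ := by
  induction N with
  | zero =>
    exact fun H hd => contDiffOn_zero.2 fun x hx =>
      (hσ.hasFDerivAt_fourierDiv H hd hx).continuousAt.continuousWithinAt
  | succ N ih =>
    intro d h H hd
    push_cast
    rw [contDiffOn_succ_iff_fderiv_of_isOpen isOpen_compl_singleton]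
    refine ⟨fun x hx =>
      (hσ.hasFDerivAt_fourierDiv H hd hx).differentiableAt.differentiableWithinAt, by simp, ?_⟩
    have hgrad : ContDiffOn ℝ N (fun x => grad fun k => fourierDiv σ (coordMul k h) x) {0}ᶜ :=
      grad.contDiff.comp_contDiffOn (contDiffOn_pi.2 fun k =>
        ih (H.coordMul k) (by linarith [hσ.weight_pos k]))
    exact hgrad.congr fun x hx => (hσ.hasFDerivAt_fourierDiv H hd hx).fderiv

theorem isHomog_fourierDiv (hσ : IsGauge γ D σ) (H : IsHomog γ d h) (hd : D - homDim γ < d) :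
    IsHomog γ (D - homDim γ - d) (fourierDiv σ h) where
  contDiffOn := contDiffOn_infty.2 fun N => hσ.contDiffOn_nat_fourierDiv N H hd
  map_dilate _ hs x _ := hσ.fourierDiv_dilate H hs x

theorem pderiv_fourierDiv (hσ : IsGauge γ D σ) (H : IsHomog γ d h) (hd : D - homDim γ < d)
    (hx : x ≠ 0) (k : Fin n) :
    pderiv k (fourierDiv σ h) x = fourierDiv σ (coordMul k h) x := by
  have := (hσ.hasFDerivAt_fourierDiv H hd hx).hasLineDerivAt (Pi.single k 1)
  rw [grad_single] at this
  exact this.lineDeriv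

theorem fourierDiv_sum_mul (hσ : IsGauge γ D σ) {ι : Type*} (s : Finset ι) (c : ι → ℂ)
    {h : ι → (Fin n → ℝ) → ℂ} (H : ∀ i ∈ s, IsHomog γ d (h i)) (hd : D - homDim γ < d)
    (hx : x ≠ 0) :
    fourierDiv σ (fun z => ∑ i ∈ s, c i * h i z) x = ∑ i ∈ s, c i * fourierDiv σ (h i) x := by
  have hheat : ∀ t ∈ Ioi (0 : ℝ), heatFourier σ (fun z => ∑ i ∈ s, c i * h i z) x t =
      ∑ i ∈ s, c i * heatFourier σ (h i) x t := fun t ht => by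
    have hint : ∀ i ∈ s, Integrable fun z =>
        c i * (phase x z * (h i z * (Real.exp (-(t * σ z)) : ℂ))) := fun i hi =>
      (integrable_phase_mul (hσ.integrable_mul_exp (H i hi) (by linarith [hσ.degree_pos]) ht)
        x).const_mul _
    simp only [heatFourier, ← integral_const_mul]
    rw [← integral_finsetSum s hint]
    congr 1 with z
    rw [Finset.sum_mul, Finset.mul_sum]
    exact Finset.sum_congr rfl fun i _ => by ring
  rw [fourierDiv, setIntegral_congr_fun measurableSet_Ioi hheat, integral_finsetSum s fun i hi =>
    (hσ.integrableOn_heatFourier (H i hi) hd hx).const_mul _]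
  simp only [integral_const_mul, fourierDiv]

theorem tendsto_heatFourier_one_atTop (hσ : IsGauge γ D σ) (x : Fin n → ℝ) :
    Filter.Tendsto (heatFourier σ (fun _ => 1) x) Filter.atTop (nhds 0) := by
  obtain ⟨C, hC⟩ := hσ.exists_norm_heatFourier_le (IsHomog.const γ 1)
  have hQ := div_pos (homDim_pos hσ.weight_pos) hσ.degree_pos
  have hlim : Filter.Tendsto (fun t : ℝ => C * t ^ ((-homDim γ - 0) / D)) Filter.atTop
      (nhds 0) := by
    simpa [neg_div] using (tendsto_rpow_neg_atTop hQ).const_mul C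
  refine squeeze_zero_norm' ?_ hlim
  filter_upwards [Filter.eventually_gt_atTop 0] with t ht using hC x t ht

theorem tendsto_heatFourier_one_zero (hσ : IsGauge γ D σ) (hx : x ≠ 0) :
    Filter.Tendsto (heatFourier σ (fun _ => 1) x) (nhdsWithin 0 (Ioi 0)) (nhds 0) := by
  obtain ⟨k, hk⟩ := Function.ne_iff.1 hx
  have hk' : 0 < |x k| := abs_pos.2 hk
  have H := IsHomog.const γ (1 : ℂ)
  have hkQ := lt_homDim hσ.weight_pos k
  obtain ⟨a, e, C, he, hC⟩ := hσ.exists_abs_pow_mul_norm_heatFourier_le_rpow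
    (H.mul (hσ.isHomog.ofReal.pderiv k)) (by linarith) k
  have hlim : Filter.Tendsto (fun t : ℝ => C / |x k| ^ (a + 1) * t ^ (1 + e))
      (nhdsWithin 0 (Ioi 0)) (nhds 0) := by
    have hcont := (Real.continuousAt_rpow_const 0 (1 + e) (Or.inr (by linarith))).tendsto
    rw [Real.zero_rpow (by linarith)] at hcont
    simpa using (hcont.mono_left nhdsWithin_le_nhds).const_mul (C / |x k| ^ (a + 1))
  refine squeeze_zero_norm' ?_ hlim
  filter_upwards [self_mem_nhdsWithin] with t ht
  have ht' : 0 < t := ht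
  have hpderiv : heatFourier σ (pderiv k fun _ => 1) x t = 0 := by
    simp [heatFourier, pderiv, lineDeriv]
  have hparts := congrArg norm (hσ.coord_mul_heatFourier H k (by linarith) ht x)
  simp only [hpderiv, sub_zero, norm_mul, Complex.norm_I, Complex.norm_real, Real.norm_eq_abs,
    abs_of_pos ht', one_mul] at hparts
  simp only [one_mul] at hC
  rw [div_mul_eq_mul_div, le_div_iff₀ (by positivity), Real.rpow_add ht', Real.rpow_one]
  calc ‖heatFourier σ (fun _ => 1) x t‖ * |x k| ^ (a + 1)
      = |x k| ^ a * (|x k| * ‖heatFourier σ (fun _ => 1) x t‖) := by ring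
    _ = t * (|x k| ^ a * ‖heatFourier σ (pderiv k fun z => (σ z : ℂ)) x t‖) := by
      rw [hparts]
      ring
    _ ≤ t * (C * t ^ e) := mul_le_mul_of_nonneg_left (hC x t ht) ht'.le
    _ = C * (t * t ^ e) := by ring

/- The heat kernel `∫ e^{ix·z - tσ(z)} dz` has `t`-derivative `-∫ e^{ix·z} σ(z) e^{-tσ(z)} dz` and
vanishes at both ends of `(0, ∞)` when `x ≠ 0`. -/
theorem fourierDiv_self (hσ : IsGauge γ D σ) (hx : x ≠ 0) :
    fourierDiv σ (fun z => (σ z : ℂ)) x = 0 := by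
  have hQ := homDim_pos hσ.weight_pos
  have hderiv : ∀ t ∈ Ioi (0 : ℝ), HasDerivAt (heatFourier σ (fun _ => 1) x)
      (-heatFourier σ (fun z => (σ z : ℂ)) x t) t := fun t ht => by
    simpa only [one_mul] using
      hσ.hasDerivAt_heatFourier (IsHomog.const γ 1) (by linarith) ht x
  have hint : IntegrableOn (fun t => -heatFourier σ (fun z => (σ z : ℂ)) x t) (Ioi 0) :=
    (hσ.integrableOn_heatFourier hσ.isHomog.ofReal (by linarith) hx).neg
  have hFTC := integral_Ioi_deriv_mul_eq_sub (a := 0) (a' := 0) (b' := 0) (v := fun _ => (1 : ℂ))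
    (v' := 0) hderiv (fun t _ => hasDerivAt_const t 1) ?_ ?_ ?_
  · simpa [integral_neg, fourierDiv] using hFTC
  · simpa [Pi.mul_def] using hint
  · simpa [Pi.mul_def] using hσ.tendsto_heatFourier_one_zero hx
  · simpa [Pi.mul_def] using hσ.tendsto_heatFourier_one_atTop x

end IsGauge

end Semielliptic

/-! ### The semielliptic operator -/

namespace Semielliptic

variable {n : ℕ}

theorem iPow_add_single (z : Fin n → ℝ) (β : Fin n → ℕ) (k : Fin n) :
    iPow z (β + Pi.single k 1) = Complex.I * z k * iPow z β := by
  have hsingle : ∏ j, (Complex.I * (z j : ℂ)) ^ (Pi.single k 1 : Fin n → ℕ) j =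
      Complex.I * z k := by
    simp [Pi.single_apply, pow_ite]
  simp only [iPow, Pi.add_apply, pow_add, Finset.prod_mul_distrib]
  rw [hsingle, mul_comm]

section Mderiv

variable {f g : (Fin n → ℝ) → ℂ} {s : Set (Fin n → ℝ)}
  {u : (Fin n → ℕ) → (Fin n → ℝ) → ℂ}

theorem eqOn_pderiv (hs : IsOpen s) (hfg : EqOn f g s) (k : Fin n) :
    EqOn (pderiv k f) (pderiv k g) s := fun _ hx =>
  (hfg.eventuallyEq_of_mem (hs.mem_nhds hx)).lineDeriv_eq

theorem eqOn_iterate_pderiv (hs : IsOpen s)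
    (hu : ∀ β k, EqOn (pderiv k (u β)) (u (β + Pi.single k 1)) s) (k : Fin n) (a : ℕ)
    {β : Fin n → ℕ} (hf : EqOn f (u β) s) :
    EqOn ((pderiv k)^[a] f) (u (Pi.single k a + β)) s := by
  induction a with
  | zero => simpa using hf
  | succ a ih =>
    rw [Function.iterate_succ_apply', Pi.single_add, add_right_comm]
    exact (eqOn_pderiv hs ih k).trans (hu _ k)

theorem eqOn_mderiv (hs : IsOpen s)
    (hu : ∀ β k, EqOn (pderiv k (u β)) (u (β + Pi.single k 1)) s) (β : Fin n → ℕ) :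
    EqOn (mderiv β (u 0)) (u β) s := by
  have hfoldr : ∀ L : List (Fin n), EqOn (L.foldr (fun k g => (pderiv k)^[β k] g) (u 0))
      (u (L.map fun k => Pi.single k (β k)).sum) s := by
    intro L
    induction L with
    | nil => exact eqOn_refl _ _
    | cons k L ih =>
      rw [List.foldr_cons, List.map_cons, List.sum_cons]
      exact eqOn_iterate_pderiv hs hu k (β k) ih
  have hsum : ((List.finRange n).map fun k => Pi.single k (β k)).sum = β := by
    rw [← Fin.sum_univ_def, Finset.univ_sum_single]
  simpa only [mderiv, hsum] using hfoldr (List.finRange n)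

end Mderiv

theorem frob_le_sum {m p : ℕ} (M : Matrix (Fin m) (Fin p) ℂ) : frob M ≤ ∑ i, ∑ j, ‖M i j‖ := by
  refine Real.sqrt_le_iff.2 ⟨by positivity, ?_⟩
  calc ∑ i, ∑ j, ‖M i j‖ ^ 2 ≤ ∑ i, (∑ j, ‖M i j‖) ^ 2 :=
        Finset.sum_le_sum fun i _ => Finset.sum_sq_le_sq_sum_of_nonneg fun j _ => norm_nonneg _
    _ ≤ (∑ i, ∑ j, ‖M i j‖) ^ 2 := Finset.sum_sq_le_sq_sum_of_nonneg fun i _ => by positivity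

theorem contDiff_det {E ι : Type*} [NormedAddCommGroup E] [NormedSpace ℝ E] [Fintype ι]
    [DecidableEq ι] {N : WithTop ℕ∞} {M : E → Matrix ι ι ℂ}
    (hM : ∀ i j, ContDiff ℝ N fun z => M z i j) : ContDiff ℝ N fun z => (M z).det := by
  simp only [Matrix.det_apply]
  exact ContDiff.sum fun τ _ => (contDiff_prod fun i _ => hM (τ i) i).const_smul _

theorem contDiff_adjugate {E ι : Type*} [NormedAddCommGroup E] [NormedSpace ℝ E] [Fintype ι]
    [DecidableEq ι] {N : WithTop ℕ∞} {M : E → Matrix ι ι ℂ}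
    (hM : ∀ i j, ContDiff ℝ N fun z => M z i j) (i j : ι) :
    ContDiff ℝ N fun z => (M z).adjugate i j := by
  simp only [Matrix.adjugate_apply]
  refine contDiff_det fun a b => ?_
  rcases eq_or_ne a j with rfl | ha
  · simpa only [Matrix.updateRow_self] using contDiff_const
  · simpa only [Matrix.updateRow_ne ha] using hM a b

end Semielliptic

namespace SemiellipticOperator

open Semielliptic

variable {n m : ℕ} (P : SemiellipticOperator n m)

theorem cast_l_pos : (0 : ℝ) < P.l := Nat.cast_pos.2 P.l_pos

theorem γ_pos (k : Fin n) : 0 < P.γ k := div_pos P.cast_l_pos (Nat.cast_pos.2 (P.ls_pos k))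

theorem γ_mul_ls (k : Fin n) : P.γ k * P.ls k = P.l :=
  div_mul_cancel₀ _ (Nat.cast_pos.2 (P.ls_pos k)).ne'

theorem γ_le (k : Fin n) : P.γ k ≤ P.l :=
  div_le_self P.cast_l_pos.le (Nat.one_le_cast.2 (P.ls_pos k))

theorem nontrivial_of_lt_γnorm (hγ : (P.l : ℝ) < P.γnorm) : Nontrivial (Fin n) := by
  by_contra hn
  rw [not_nontrivial_iff_subsingleton] at hn
  refine hγ.not_ge ?_
  rcases isEmpty_or_nonempty (Fin n) with _ | ⟨⟨k⟩⟩
  · simp [γnorm]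
  · rw [γnorm, Fintype.sum_subsingleton _ k]
    exact P.γ_le k

theorem σ_nonneg (z : Fin n → ℝ) : 0 ≤ P.σ z :=
  Finset.sum_nonneg fun _ _ => (even_two_mul _).pow_nonneg _

theorem σ_pos {z : Fin n → ℝ} (hz : z ≠ 0) : 0 < P.σ z := by
  obtain ⟨k, hk⟩ := Function.ne_iff.1 hz
  exact Finset.sum_pos' (fun j _ => (even_two_mul _).pow_nonneg _)
    ⟨k, Finset.mem_univ _, (even_two_mul _).pow_pos hk⟩

theorem σ_dilate {s : ℝ} (hs : 0 < s) (z : Fin n → ℝ) :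
    P.σ (dilate P.γ s z) = s ^ (2 * (P.l : ℝ)) * P.σ z := by
  simp only [σ, dilate, Finset.mul_sum, mul_pow]
  refine Finset.sum_congr rfl fun k _ => ?_
  rw [← Real.rpow_natCast (s ^ P.γ k), ← Real.rpow_mul hs.le, ← P.γ_mul_ls k]
  congr 2
  push_cast
  ring

theorem isGauge_σ : IsGauge P.γ (2 * P.l) P.σ where
  weight_pos := P.γ_pos
  weight_lt k := by linarith [P.γ_le k, P.cast_l_pos]
  pos _ := P.σ_pos
  isHomog :=
    { contDiffOn := by
        unfold σ
        fun_prop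
      map_dilate _ hs z _ := P.σ_dilate hs z }

theorem ρ_rpow (z : Fin n → ℝ) (d : ℝ) : P.ρ z ^ d = P.σ z ^ (d / (2 * P.l)) := by
  rw [ρ, ← Real.rpow_mul (P.σ_nonneg z), one_div_mul_eq_div]

theorem contDiff_symbol_apply (i j : Fin m) : ContDiff ℝ ∞ (fun z => P.symbol z i j) := by
  simp only [symbol, symbolOf, Matrix.sum_apply, Matrix.smul_apply, iPow, smul_eq_mul]
  have : ∀ k : Fin n, ContDiff ℝ ∞ fun z : Fin n → ℝ => (z k : ℂ) := fun k =>
    Complex.ofRealCLM.contDiff.comp (contDiff_apply ℝ ℝ k)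
  fun_prop

theorem symbol_dilate {s : ℝ} (hs : 0 < s) {z : Fin n → ℝ} (hz : z ≠ 0) :
    P.symbol (dilate P.γ s z) = s ^ (P.l : ℝ) • P.symbol z := by
  simp only [symbol, symbolOf, Finset.smul_sum]
  refine Finset.sum_congr rfl fun α hα => ?_
  have hα' : dot α P.γ = P.l := (mem_indices P.l_pos P.ls_pos α).1 hα
  rw [(IsHomog.iPow P.γ α).map_dilate hs hz, hα', smul_assoc]

theorem isUnit_det_symbol {z : Fin n → ℝ} (hz : z ≠ 0) : IsUnit (P.symbol z).det :=
  (Matrix.isUnit_iff_isUnit_det _).1 (P.invertible z hz)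

theorem symbol_inv_dilate {s : ℝ} (hs : 0 < s) {z : Fin n → ℝ} (hz : z ≠ 0) :
    (P.symbol (dilate P.γ s z))⁻¹ = s ^ (-P.l : ℝ) • (P.symbol z)⁻¹ := by
  refine Matrix.inv_eq_right_inv ?_
  rw [P.symbol_dilate hs hz, smul_mul_smul_comm, Matrix.mul_nonsing_inv _ (P.isUnit_det_symbol hz),
    ← Real.rpow_add hs, add_neg_cancel, Real.rpow_zero, one_smul]

theorem isHomog_symbol_inv (i j : Fin m) :
    IsHomog P.γ (-P.l) (fun z => (P.symbol z)⁻¹ i j) where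
  contDiffOn := by
    simp only [Matrix.inv_def, Ring.inverse_eq_inv', Matrix.smul_apply, smul_eq_mul]
    exact ((contDiff_det P.contDiff_symbol_apply).contDiffOn.inv
      fun z hz => (P.isUnit_det_symbol hz).ne_zero).mul
        (contDiff_adjugate P.contDiff_symbol_apply i j).contDiffOn
  map_dilate s hs z hz := by rw [P.symbol_inv_dilate hs hz, Matrix.smul_apply]

/-- The entries of `(iz)^β σ(z) L(z)⁻¹`, the homogeneous functions whose quotients by `σ` are
Fourier transformed in the definition of `F_β`. -/
def kernel (β : Fin n → ℕ) (i j : Fin m) (z : Fin n → ℝ) : ℂ :=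
  iPow z β * P.σ z * (P.symbol z)⁻¹ i j

theorem isHomog_kernel (β : Fin n → ℕ) (i j : Fin m) :
    IsHomog P.γ (dot β P.γ + P.l) (P.kernel β i j) := by
  have := ((IsHomog.iPow P.γ β).mul P.isGauge_σ.isHomog.ofReal).mul (P.isHomog_symbol_inv i j)
  rwa [show dot β P.γ + 2 * P.l + -P.l = dot β P.γ + (P.l : ℝ) by ring] at this

theorem coordMul_kernel (β : Fin n → ℕ) (i j : Fin m) (k : Fin n) :
    coordMul k (P.kernel β i j) = P.kernel (β + Pi.single k 1) i j := by
  funext z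
  simp only [coordMul, kernel, iPow_add_single]
  ring

theorem sum_coeff_mul_kernel {z : Fin n → ℝ} (hz : z ≠ 0) (i j : Fin m) :
    ∑ α ∈ indices P.l P.ls, ∑ k, P.A α i k * P.kernel α k j z =
      (1 : Matrix (Fin m) (Fin m) ℂ) i j * P.σ z := by
  rw [← Matrix.mul_nonsing_inv _ (P.isUnit_det_symbol hz), Matrix.mul_apply, Finset.sum_mul,
    Finset.sum_comm]
  refine Finset.sum_congr rfl fun k _ => ?_
  rw [symbol, symbolOf, Matrix.sum_apply, Finset.sum_mul, Finset.sum_mul]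
  refine Finset.sum_congr rfl fun α _ => ?_
  simp only [kernel, symbol, symbolOf, Matrix.smul_apply, smul_eq_mul]
  ring

theorem integrandβ_apply (β : Fin n → ℕ) (x : Fin n → ℝ) (t : ℝ) (z : Fin n → ℝ) (i j : Fin m) :
    P.integrandβ β x t z i j =
      phase x z * (P.kernel β i j z * (Real.exp (-(t * P.σ z)) : ℂ)) := by
  simp only [integrandβ, kernel, phase, Matrix.smul_apply, smul_eq_mul]
  ring

theorem Jβ_apply (β : Fin n → ℕ) (x : Fin n → ℝ) (t : ℝ) (i j : Fin m) :
    P.Jβ β x t i j = heatFourier P.σ (P.kernel β i j) x t := by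
  simp only [Jβ, Matrix.of_apply, heatFourier, integrandβ_apply]

theorem Fβ_apply (β : Fin n → ℕ) (x : Fin n → ℝ) (i j : Fin m) :
    P.Fβ β x i j = ((2 * Real.pi) ^ n)⁻¹ • fourierDiv P.σ (P.kernel β i j) x := by
  simp only [Fβ, Matrix.smul_apply, Matrix.of_apply, fourierDiv, Jβ_apply]

theorem F_eq_Fβ_zero : P.F = P.Fβ 0 := by
  funext x
  simp only [F, Fβ, Jβ, integrand, integrandβ, iPow, Pi.zero_apply, pow_zero, Finset.prod_const_one,
    mul_one, Matrix.of_apply]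

theorem Fβ_dilate [Nonempty (Fin n)] (β : Fin n → ℕ) {s : ℝ} (hs : 0 < s) (x : Fin n → ℝ) :
    P.Fβ β (dilate P.γ s x) = s ^ (P.l - dot β P.γ - P.γnorm) • P.Fβ β x := by
  ext i j
  rw [Matrix.smul_apply, Fβ_apply, Fβ_apply, P.isGauge_σ.fourierDiv_dilate (P.isHomog_kernel β i j)
    hs x, smul_comm]
  congr 2
  simp only [homDim, γnorm]
  ring

theorem lt_dot_add_l (hγ : (P.l : ℝ) < P.γnorm) (β : Fin n → ℕ) :
    2 * P.l - homDim P.γ < dot β P.γ + P.l := by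
  have hγ' : (P.l : ℝ) < homDim P.γ := hγ
  linarith [dot_nonneg (fun k => (P.γ_pos k).le) β]

theorem integrable_integrandβ [Nonempty (Fin n)] (hγ : (P.l : ℝ) < P.γnorm) (β : Fin n → ℕ)
    (x : Fin n → ℝ) {t : ℝ} (ht : 0 < t) (i j : Fin m) :
    Integrable fun z => P.integrandβ β x t z i j := by
  simp only [integrandβ_apply]
  exact integrable_phase_mul (P.isGauge_σ.integrable_mul_exp (P.isHomog_kernel β i j)
    (by linarith [P.lt_dot_add_l hγ β, P.cast_l_pos]) ht) x

section

variable [Nontrivial (Fin n)]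

theorem integrableOn_Jβ (hγ : (P.l : ℝ) < P.γnorm) (β : Fin n → ℕ) {x : Fin n → ℝ} (hx : x ≠ 0)
    (i j : Fin m) : IntegrableOn (fun t => P.Jβ β x t i j) (Ioi 0) := by
  simp only [Jβ_apply]
  exact P.isGauge_σ.integrableOn_heatFourier (P.isHomog_kernel β i j) (P.lt_dot_add_l hγ β) hx

theorem isHomog_Fβ (hγ : (P.l : ℝ) < P.γnorm) (β : Fin n → ℕ) (i j : Fin m) :
    IsHomog P.γ (P.l - dot β P.γ - P.γnorm) (fun x => P.Fβ β x i j) where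
  contDiffOn := by
    simp only [Fβ_apply]
    exact (P.isGauge_σ.isHomog_fourierDiv (P.isHomog_kernel β i j)
      (P.lt_dot_add_l hγ β)).contDiffOn.const_smul _
  map_dilate _ hs x _ := by rw [P.Fβ_dilate β hs x, Matrix.smul_apply]

theorem contDiffOn_F (hγ : (P.l : ℝ) < P.γnorm) (i j : Fin m) :
    ContDiffOn ℝ ∞ (fun x => P.F x i j) {0}ᶜ := by
  rw [F_eq_Fβ_zero]
  exact (P.isHomog_Fβ hγ 0 i j).contDiffOn

theorem exists_frob_Fβ_le (hγ : (P.l : ℝ) < P.γnorm) (β : Fin n → ℕ) :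
    ∃ C : ℝ, ∀ x : Fin n → ℝ, x ≠ 0 →
      frob (P.Fβ β x) ≤ C * P.ρ x ^ (P.l - dot β P.γ - P.γnorm) := by
  choose C _ hC using fun i j => P.isGauge_σ.exists_norm_le (P.isHomog_Fβ hγ β i j)
  refine ⟨∑ i, ∑ j, C i j, fun x hx => (frob_le_sum _).trans ?_⟩
  simp only [Finset.sum_mul, ρ_rpow]
  exact Finset.sum_le_sum fun i _ => Finset.sum_le_sum fun j _ => hC i j x hx

theorem pderiv_Fβ (hγ : (P.l : ℝ) < P.γnorm) (β : Fin n → ℕ) (i j : Fin m) (k : Fin n) :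
    EqOn (pderiv k fun x => P.Fβ β x i j) (fun x => P.Fβ (β + Pi.single k 1) x i j) {0}ᶜ := by
  intro x hx
  have H := P.isHomog_kernel β i j
  have hd := P.lt_dot_add_l hγ β
  have hderiv := (P.isGauge_σ.isHomog_fourierDiv H hd).hasLineDerivAt hx k
  rw [P.isGauge_σ.pderiv_fourierDiv H hd hx, coordMul_kernel] at hderiv
  simp only [Fβ_apply]
  exact (HasDerivAt.const_smul ((2 * Real.pi) ^ n)⁻¹ hderiv).deriv

theorem matDeriv_F (hγ : (P.l : ℝ) < P.γnorm) (β : Fin n → ℕ) {x : Fin n → ℝ} (hx : x ≠ 0) :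
    matDeriv β P.F x = P.Fβ β x := by
  ext i j
  rw [F_eq_Fβ_zero, matDeriv, Matrix.of_apply]
  exact eqOn_mderiv (u := fun β x => P.Fβ β x i j) isOpen_compl_singleton
    (fun β k => P.pderiv_Fβ hγ β i j k) β hx

theorem sum_coeff_mul_fourierDiv_kernel {x : Fin n → ℝ} (hx : x ≠ 0) (i j : Fin m) :
    ∑ α ∈ indices P.l P.ls, ∑ k, P.A α i k * fourierDiv P.σ (P.kernel α k j) x = 0 := by
  have hσ := P.isGauge_σ
  have hd : 2 * P.l - homDim P.γ < 2 * P.l := by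
    linarith [homDim_pos P.γ_pos]
  have H : ∀ a ∈ indices P.l P.ls ×ˢ Finset.univ,
      IsHomog P.γ (2 * P.l) (P.kernel a.1 a.2 j) := fun a ha => by
    have hα : dot a.1 P.γ = P.l :=
      (mem_indices P.l_pos P.ls_pos _).1 (Finset.mem_product.1 ha).1
    rw [two_mul]
    exact hα ▸ P.isHomog_kernel a.1 a.2 j
  calc ∑ α ∈ indices P.l P.ls, ∑ k, P.A α i k * fourierDiv P.σ (P.kernel α k j) x
      = fourierDiv P.σ (fun z => ∑ α ∈ indices P.l P.ls, ∑ k, P.A α i k * P.kernel α k j z) x := by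
        simp only [← Finset.sum_product']
        exact (hσ.fourierDiv_sum_mul _ (fun a => P.A a.1 i a.2) H hd hx).symm
    _ = fourierDiv P.σ (fun z => (1 : Matrix (Fin m) (Fin m) ℂ) i j * P.σ z) x :=
        congrFun (fourierDiv_congr fun z hz => P.sum_coeff_mul_kernel hz i j) x
    _ = (1 : Matrix (Fin m) (Fin m) ℂ) i j * fourierDiv P.σ (fun z => (P.σ z : ℂ)) x :=
        fourierDiv_const_mul _ _ x
    _ = 0 := by rw [hσ.fourierDiv_self hx, mul_zero]

theorem act_F (hγ : (P.l : ℝ) < P.γnorm) {x : Fin n → ℝ} (hx : x ≠ 0) : P.act P.F x = 0 := by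
  ext i j
  simp only [act, P.matDeriv_F hγ _ hx, Matrix.sum_apply, Matrix.mul_apply, Fβ_apply,
    mul_smul_comm, ← Finset.smul_sum, P.sum_coeff_mul_fourierDiv_kernel hx, smul_zero,
    Matrix.zero_apply]

end

end SemiellipticOperator

end

theorem theorem3p1 {n m : ℕ} (P : SemiellipticOperator n m) (hγ : (P.l : ℝ) < P.γnorm) :
    -- (a) absolute convergence (inner and outer integral) and the bound
    (∀ β : Fin n → ℕ,
      (∀ x : Fin n → ℝ, x ≠ 0 → ∀ i j : Fin m,
        (∀ t : ℝ, 0 < t → Integrable (fun z : Fin n → ℝ => P.integrandβ β x t z i j)) ∧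
        IntegrableOn (fun t : ℝ => P.Jβ β x t i j) (Ioi 0)) ∧
      ∃ C : ℝ, ∀ x : Fin n → ℝ, x ≠ 0 →
        Semielliptic.frob (P.Fβ β x) ≤
          C * P.ρ x ^ ((P.l : ℝ) - Semielliptic.dot β P.γ - P.γnorm)) ∧
    -- (b) smoothness, and the formal derivatives are the derivatives
    ((∀ i j : Fin m, ContDiffOn ℝ ∞ (fun x => P.F x i j) {0}ᶜ) ∧
      ∀ β : Fin n → ℕ, ∀ x : Fin n → ℝ, x ≠ 0 → Semielliptic.matDeriv β P.F x = P.Fβ β x) ∧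
    -- (c) anisotropic homogeneity
    (∀ β : Fin n → ℕ, ∀ s : ℝ, 0 < s → ∀ x : Fin n → ℝ,
      P.Fβ β (Semielliptic.dilate P.γ s x) =
        s ^ ((P.l : ℝ) - Semielliptic.dot β P.γ - P.γnorm) • P.Fβ β x) ∧
    -- (d) the equation away from the origin
    (∀ x : Fin n → ℝ, x ≠ 0 → P.act P.F x = 0) := by
  have := P.nontrivial_of_lt_γnorm hγ
  refine ⟨fun β => ⟨fun x hx i j => ⟨fun t ht => ?_, ?_⟩, ?_⟩, ⟨fun i j => ?_, fun β x hx => ?_⟩,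
    fun β s hs x => ?_, fun x hx => ?_⟩
  · exact P.integrable_integrandβ hγ β x ht i j
  · exact P.integrableOn_Jβ hγ β hx i j
  · exact P.exists_frob_Fβ_le hγ β
  · exact P.contDiffOn_F hγ i j
  · exact P.matDeriv_F hγ β hx
  · exact P.Fβ_dilate β hs x
  · exact P.act_F hγ hx
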